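/- \textbf{Setting.} A strongly regular D-GLDPC ensemble sequence $\{\mathcal M_n\}$ is given by integers $k,q,s$ as follows. There are $n$ variable nodes (VNs), each a binary $(q,k)$ linear code with a rank-$k$ generator matrix $\mathbf G$ mapping local input words $a\in\mathbb F_2^k$ to $a\mathbf G$, and all with the same input-output weight enumerating function $B(x,y)=\sum_{u,v}B_{u,v}x^uy^v$, where $B_{u,v}$ is the number of weight-$u$ input words producing weight-$v$ local codewords. There are $nq/s$ check nodes (CNs) ($n$ is such that $s\mid nq$), each a nonzero binary linear code of length $s$, and all with the same weight enumerating function $A(z)=\sum_u A_uz^u$. A member of $\mathcal M_n$ is a bijection, chosen uniformly at random, between the $nq$ VN sockets and the $nq$ CN sockets. Its codewords are the words in $(\mathbb F_2^{k})^n$ such that, when each VN encodes its $k$ bits, every CN receives a word of its local code; $N_w$ is the number of codewords of weight $w$. Put $\int\lambda=\int_0^1x^{q-1}dx=1/q$, $\int\rho=\int_0^1x^{s-1}dx=1/s$, and $h(p)=-p\log p-(1-p)\log(1-p)$ with $h(0)=h(1)=0$. The growth rate is $G(\alpha)=\lim_{n\to\infty}\frac1n\log\mathbb E_{\mathcal M_n}[N_{\alpha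 n}]$. The limit is over $n\to\infty$ with $s\mid nq$ and integer weights $w$ with $w/n\to\alpha$ (in particular $w=\alpha n$) for which the expectation is nonzero; $G(\alpha)=-\infty$ means that the expectation is zero for all such $n,w$ with $n$ large enough and $w/n$ close enough to $\alpha$. For $1\le i\le k$ let $U_i$ and $V_i$ be the smallest and the largest $j$ with $B_{i,j}>0$, and let $$m(\alpha)=\min_\omega\sum_{i=1}^kU_i\omega_i,\qquad M(\alpha)=\max_\omega\sum_{i=1}^kV_i\omega_i$$ over all $\omega\in\mathbb R^k$ with $\omega_i\ge0$, $\sum_i\omega_i\le1$, $\sum_i i\,\omega_i=\alpha$. Let $\bar\beta=(\int\rho/\int\lambda)\deg A$. \textbf{Statement.} Let $0<\alpha<k$. Consider the saddle-point equations $$\frac{\partial_xB(x_0,y_0)}{B(x_0,y_0)}x_0=\alpha,\qquad \frac{\partial_yB(x_0,y_0)}{B(x_0,y_0)}y_0=\beta,\qquad \frac{A'(z_0)}{A(z_0)}z_0=\beta\,\frac{\int\lambda}{\int\rho}.$$ (a) For $m(\alpha)<\beta<M(\alpha)$ the first two have a unique positive real solution $(x_0,y_0)$. If $m(\alpha)=M(\alpha)=\beta$,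 they have a positive solution. For $0<\beta<\bar\beta$ the third has a unique positive real solution $z_0$. (b) There are functions $X$, continuous on $[m(\alpha),M(\alpha)]$, and $Y$, continuous on $(0,\bar\beta]$, with $$X(\beta)=\log\frac{B(x_0,y_0)}{x_0^\alpha y_0^\beta},\qquad Y(\beta)=\log\frac{A(z_0)^{\int\rho/\int\lambda}}{z_0^\beta}-\frac{h(\beta\int\lambda)}{\int\lambda}$$ for every positive solution $(x_0,y_0)$, respectively $z_0$, of the equations at $\beta$; by (a), these functions are uniquely determined. If $[m(\alpha),M(\alpha)]\cap(0,\bar\beta]\neq\emptyset$, the growth rate exists and $$G(\alpha)=\max_{m(\alpha)\le\beta\le M(\alpha),\ 0<\beta\le\bar\beta}\bigl[X(\beta)+Y(\beta)\bigr].$$ In this case there are pairs $(n,w)$ with $n$ arbitrarily large, $w/n$ arbitrarily close to $\alpha$ and $\mathbb E_{\mathcal M_n}[N_w]>0$, and for rational $\alpha$ there are infinitely many $n$ for which $w=\alpha n$ is such a weight. (c) If $[m(\alpha),M(\alpha)]\cap(0,\bar\beta]=\emptyset$, then $G(\alpha)=-\infty$. -/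

import Mathlib

noncomputable section

namespace DGLDPC

/-- Number of weight-`u` codewords of a check node (CN) with local code `C`. -/
def wefCoeff {s : ℕ} (C : Submodule (ZMod 2) (Fin s → ZMod 2)) (u : ℕ) : ℕ :=
  Nat.card {c : Fin s → ZMod 2 // c ∈ C ∧ hammingNorm c = u}

/-- Number of weight-`v` local codewords generated by weight-`u` local input words, for a variable
node (VN) with generator matrix `G`. -/
def ioCoeff {k q : ℕ} (G : Matrix (Fin k) (Fin q) (ZMod 2)) (u v : ℕ) : ℕ :=
  Nat.card {a : Fin k → ZMod 2 // hammingNorm a = u ∧ hammingNorm (Matrix.vecMul a G) = v}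

/-- The weight enumerating function `A(z)` of a CN. -/
def wef {s : ℕ} (C : Submodule (ZMod 2) (Fin s → ZMod 2)) (z : ℝ) : ℝ :=
  ∑ u ∈ Finset.range (s + 1), (wefCoeff C u : ℝ) * z ^ u

/-- The input-output weight enumerating function `B(x, y)` of a VN. -/
def ioWef {k q : ℕ} (G : Matrix (Fin k) (Fin q) (ZMod 2)) (x y : ℝ) : ℝ :=
  ∑ u ∈ Finset.range (k + 1), ∑ v ∈ Finset.range (q + 1), (ioCoeff G u v : ℝ) * x ^ u * y ^ v

/-- A strongly regular D-GLDPC ensemble sequence. For every `n` there are `n` VNs, each a `(q, k)`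
linear code with a generator matrix, and `n * q / s` CNs, each a linear code of length `s`. All VNs
have the type (IO-WEF) of the generator matrix `vnRep`, and all CNs have the type (WEF) of the
code `cnRep`; nodes of the same type need not be equal. -/
structure StronglyRegularEnsemble (k q s : ℕ) where
  vnRep : Matrix (Fin k) (Fin q) (ZMod 2)
  cnRep : Submodule (ZMod 2) (Fin s → ZMod 2)
  vnRep_linearIndependent : LinearIndependent (ZMod 2) vnRep.row
  cnRep_ne_bot : cnRep ≠ ⊥
  vn : (n : ℕ) → Fin n → Matrix (Fin k) (Fin q) (ZMod 2)
  cn : (n : ℕ) → Fin (n * q / s) → Submodule (ZMod 2) (Fin s → ZMod 2)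
  vn_type : ∀ n j u v, ioCoeff (vn n j) u v = ioCoeff vnRep u v
  cn_type : ∀ n i u, wefCoeff (cn n i) u = wefCoeff cnRep u

namespace StronglyRegularEnsemble

variable {k q s : ℕ} (𝓜 : StronglyRegularEnsemble k q s)

/-- A member of the ensemble with `n` VNs: a bijection from the VN sockets to the CN sockets,
i.e. a permutation of the edges. -/
abbrev Member (_ : StronglyRegularEnsemble k q s) (n : ℕ) : Type :=
  (Fin n × Fin q) ≃ (Fin (n * q / s) × Fin s)

/-- `a` (the `k` code bits of each of the `n` VNs) is a codeword of the code given by `π`: every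
VN encodes its bits, and every CN receives a word of its local code. -/
def IsCodeword (n : ℕ) (π : 𝓜.Member n) (a : Fin n → Fin k → ZMod 2) : Prop :=
  ∀ i : Fin (n * q / s),
    (fun e : Fin s =>
      Matrix.vecMul (a (π.symm (i, e)).1) (𝓜.vn n (π.symm (i, e)).1) (π.symm (i, e)).2) ∈ 𝓜.cn n i

/-- The number `N_w` of codewords of weight `w` of the code given by `π`. -/
def numCodewords (n : ℕ) (π : 𝓜.Member n) (w : ℕ) : ℕ :=
  Nat.card {a : Fin n → Fin k → ZMod 2 // 𝓜.IsCodeword n π a ∧ ∑ j, hammingNorm (a j) = w}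

/-- The expectation of `N_w` over the ensemble with `n` VNs (uniform edge permutation). It is used
only where `s ∣ n * q`, i.e. where the ensemble with `n` VNs exists. -/
def expNumCodewords (n w : ℕ) : ℝ :=
  (∑ π : 𝓜.Member n, (𝓜.numCodewords n π w : ℝ)) / (Fintype.card (𝓜.Member n) : ℝ)

/-- Pairs `(n, w)` such that the ensemble with `n` VNs exists, `n → ∞` and `w / n → α`. -/
def weightFilter (_ : StronglyRegularEnsemble k q s) (α : ℝ) : Filter (ℕ × ℕ) :=
  Filter.comap Prod.fst Filter.atTop ⊓
    Filter.comap (fun p : ℕ × ℕ => (p.2 : ℝ) / (p.1 : ℝ)) (nhds α) ⊓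
    Filter.principal {p | s ∣ p.1 * q}

/-- `G(α) = g`, where `G(α) = lim (1/n) log E[N_{αn}]`. The limit runs over pairs `(n, w)` with
`w / n → α` (in particular over `w = αn`) for which the expectation does not vanish; such pairs
occur with arbitrarily large `n`, and for rational `α` they occur with `w = αn` exactly. -/
def HasGrowthRate (α g : ℝ) : Prop :=
  (∃ᶠ p in 𝓜.weightFilter α, 0 < 𝓜.expNumCodewords p.1 p.2) ∧
  ((∃ r : ℚ, (r : ℝ) = α) → ∃ᶠ n : ℕ in Filter.atTop, s ∣ n * q ∧
    ∃ w : ℕ, (w : ℝ) = α * n ∧ 0 < 𝓜.expNumCodewords n w) ∧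
  Filter.Tendsto (fun p : ℕ × ℕ => 1 / (p.1 : ℝ) * Real.log (𝓜.expNumCodewords p.1 p.2))
    (𝓜.weightFilter α ⊓ Filter.principal {p | 0 < 𝓜.expNumCodewords p.1 p.2}) (nhds g)

/-- `∫ λ`, where `λ(x) = x ^ (q - 1)`. -/
def intLambda (_ : StronglyRegularEnsemble k q s) : ℝ := ∫ x in (0 : ℝ)..1, x ^ (q - 1)

/-- `∫ ρ`, where `ρ(x) = x ^ (s - 1)`. -/
def intRho (_ : StronglyRegularEnsemble k q s) : ℝ := ∫ x in (0 : ℝ)..1, x ^ (s - 1)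

/-- The function `B(x, y)` of the ensemble. -/
def B (x y : ℝ) : ℝ := ioWef 𝓜.vnRep x y

/-- The function `A(z)` of the ensemble. -/
def A (z : ℝ) : ℝ := wef 𝓜.cnRep z

/-- Minimum local codeword weight for local input weight `i`. -/
def U (i : ℕ) : ℕ := sInf {j | 0 < ioCoeff 𝓜.vnRep i j}

/-- Maximum local codeword weight for local input weight `i`. -/
def V (i : ℕ) : ℕ := sSup {j | 0 < ioCoeff 𝓜.vnRep i j}

/-- Vectors `(ω_1, …, ω_k)` with `ω_i ≥ 0`, `∑ ω_i ≤ 1` and `∑ i ω_i = α`; the entry `ω_{i+1}` is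
stored at index `i : Fin k`. -/
def feasible (_ : StronglyRegularEnsemble k q s) (α : ℝ) : Set (Fin k → ℝ) :=
  {ω | (∀ i, 0 ≤ ω i) ∧ ∑ i, ω i ≤ 1 ∧ ∑ i : Fin k, ((i : ℝ) + 1) * ω i = α}

/-- `m(α)`: the minimum of `∑ U_i ω_i`. -/
def lower (α : ℝ) : ℝ :=
  sInf ((fun ω : Fin k → ℝ => ∑ i : Fin k, (𝓜.U (i + 1) : ℝ) * ω i) '' 𝓜.feasible α)

/-- `M(α)`: the maximum of `∑ V_i ω_i`. -/
def upper (α : ℝ) : ℝ :=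
  sSup ((fun ω : Fin k → ℝ => ∑ i : Fin k, (𝓜.V (i + 1) : ℝ) * ω i) '' 𝓜.feasible α)

/-- The largest weight of a CN codeword, which is the degree of `A`. -/
def cnMaxWeight : ℕ := sSup {u | 0 < wefCoeff 𝓜.cnRep u}

/-- `(x, y)` is a positive solution of the two VN saddle-point equations at `(α, β)`. -/
def IsVNSaddle (α β x y : ℝ) : Prop :=
  0 < x ∧ 0 < y ∧
  deriv (fun t => 𝓜.B t y) x / 𝓜.B x y * x = α ∧
  deriv (fun t => 𝓜.B x t) y / 𝓜.B x y * y = β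

/-- `z` is a positive solution of the CN saddle-point equation at `β`. -/
def IsCNSaddle (β z : ℝ) : Prop :=
  0 < z ∧ deriv 𝓜.A z / 𝓜.A z * z = β * (𝓜.intLambda / 𝓜.intRho)

/-- `X(β)` is the VN term of the growth rate at `α`: a continuous function on `[m(α), M(α)]` equal
to `log (B(x₀, y₀) / (x₀^α y₀^β))` whenever `(x₀, y₀)` solves the saddle-point equations. -/
def IsVNTerm (α : ℝ) (X : ℝ → ℝ) : Prop :=
  ContinuousOn X (Set.Icc (𝓜.lower α) (𝓜.upper α)) ∧
  ∀ β ∈ Set.Icc (𝓜.lower α) (𝓜.upper α), ∀ x₀ y₀, 𝓜.IsVNSaddle α β x₀ y₀ →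
    X β = Real.log (𝓜.B x₀ y₀ / (x₀ ^ α * y₀ ^ β))

/-- The `β > 0` for which the right-hand side of the CN saddle-point equation is at most the degree
of `A`. For larger `β` no CN words of the required weight exist. -/
def cnRange : Set ℝ := {β | 0 < β ∧ β * (𝓜.intLambda / 𝓜.intRho) ≤ 𝓜.cnMaxWeight}

/-- `Y(β)` is the CN term of the growth rate: a continuous function on the range above equal to
`log (A(z₀)^(∫ρ/∫λ) / z₀^β) - h(β ∫λ) / ∫λ` whenever `z₀` solves the saddle-point equation. -/
def IsCNTerm (Y : ℝ → ℝ) : Prop :=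
  ContinuousOn Y 𝓜.cnRange ∧
  ∀ β ∈ 𝓜.cnRange, ∀ z₀, 𝓜.IsCNSaddle β z₀ →
    Y β = Real.log (𝓜.A z₀ ^ (𝓜.intRho / 𝓜.intLambda) / z₀ ^ β)
      - Real.binEntropy (β * 𝓜.intLambda) / 𝓜.intLambda

end StronglyRegularEnsemble

end DGLDPC

end

noncomputable section

namespace DGLDPC

open Real Finset Filter Topology

/-! ### Factorials, type classes and binomial coefficients -/

/-! A uniform edge permutation carries a fixed binary word to a uniformly distributed word of the
same weight. Hence the expected number of codewords is a sum of inverse binomial coefficients over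
pairs of a tuple of VN words and a tuple of CN words whose total edge weights agree
(`expNumCodewords_eq_sum_choose`). Each summand depends only on the joint type of the pair, that is,
on how often each local word occurs. There are polynomially many types, and a type `N` contributes
`exp (n * exponent (N / n))` up to polynomial factors. So the growth rate should be the maximum of
`exponent` over the polytope `typePolytope α` of limiting types, and `hasGrowthRate_of_isGreatest`
proves this.

The upper bound is compactness: the normalized types cannot stay in a closed set that misses the
polytope. The lower bound must hold for every pair `(n, w)` with nonzero expectation, and a real
maximizer need not round to a type with exactly these parameters. Nonzero expectation supplies one
type. An integer kernel vector of the constraint system, found within bounded distance of the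
desired real displacement (`exists_int_kernel_near`), moves that type close to the maximizer.
Entries stay nonnegative because the maximizer is first perturbed to have maximal support.

The VN and CN parts of a limiting type are coupled only through the mean edge weight `β`. For fixed
`β` the maximum therefore splits into two entropy maximizations, `vnTerm` and `cnTerm`
(`exponent_le_terms`, `exists_exponent_eq_terms`). Their maximizers are exponentially tilted
distributions whenever the saddle-point equations are solvable, which gives the closed forms for `X`
and `Y`; continuity up to the boundary comes from `continuousOn_sliceSup`. Solvability is the
existence of a unique critical point of a coercive sum of exponentials
(`existsUnique_sum_exp_smul_eq_zero`). -/

lemma mul_log_sub_le_log_factorial (n : ℕ) : n * log n - n ≤ log (n.factorial : ℝ) := by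
  rcases Nat.eq_zero_or_pos n with rfl | hn
  · simp
  have hn' : (0 : ℝ) < n := by exact_mod_cast hn
  have hf : (0 : ℝ) < n.factorial := by exact_mod_cast n.factorial_pos
  -- `n ^ n / n!` is a single term of the exponential series at `n`.
  have h := Real.pow_div_factorial_le_exp (x := (n : ℝ)) hn'.le n
  rw [div_le_iff₀ hf] at h
  have h2 := Real.log_le_log (by positivity) h
  rw [Real.log_mul (Real.exp_ne_zero _) hf.ne', Real.log_exp, Real.log_pow] at h2
  linarith

/-- A crude Stirling bound suffices, since logarithmic errors vanish after division by `n`. The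
induction compares increments by means of `1 - 1 / x ≤ log x`; the coefficient 2 of the error term
is what lets these bounds close it. -/
lemma log_factorial_le (n : ℕ) :
    log (n.factorial : ℝ) ≤ n * log n - n + (1 + 2 * log (n + 1)) := by
  induction n with
  | zero => simp
  | succ n ih =>
    have h1 : (0 : ℝ) < n + 1 := by positivity
    rw [Nat.factorial_succ]
    push_cast
    rw [Real.log_mul h1.ne' (by exact_mod_cast n.factorial_ne_zero)]
    have h2 : 1 / ((n : ℝ) + 2) ≤ log ((n : ℝ) + 1 + 1) - log ((n : ℝ) + 1) := by
      rw [← Real.log_div (by positivity) h1.ne']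
      have := Real.one_sub_inv_le_log_of_pos (x := ((n : ℝ) + 1 + 1) / (n + 1)) (by positivity)
      refine le_trans (le_of_eq ?_) this
      field_simp
      ring
    have h3 : (n : ℝ) / (n + 1) ≤ n * log (n + 1) - n * log n := by
      rcases Nat.eq_zero_or_pos n with rfl | hn
      · simp
      have hn' : (0 : ℝ) < n := by exact_mod_cast hn
      rw [← mul_sub, ← Real.log_div h1.ne' hn'.ne']
      have := Real.one_sub_inv_le_log_of_pos (x := ((n : ℝ) + 1) / n) (by positivity)
      refine le_trans (le_of_eq ?_) (mul_le_mul_of_nonneg_left this hn'.le)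
      field_simp
      ring
    have h4 : 1 ≤ 2 * (1 / ((n : ℝ) + 2)) + (n : ℝ) / (n + 1) := by
      rw [← sub_nonneg]
      have : 2 * (1 / ((n : ℝ) + 2)) + (n : ℝ) / (n + 1) - 1 = n / ((n + 2) * (n + 1)) := by
        field_simp
        ring
      rw [this]
      positivity
    nlinarith

/-- The exponent of the size of the class of words of type `N`. -/
def typeExponent {S : Type*} [Fintype S] (N : S → ℝ) : ℝ := ∑ i, negMulLog (N i) - negMulLog (∑ i, N i)

/-- Subtracting the term of the total mass makes the exponent homogeneous of degree one, so it can
be evaluated on counts or on counts divided by `n`. -/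
lemma typeExponent_smul {S : Type*} [Fintype S] (c : ℝ) (N : S → ℝ) :
    typeExponent (fun i => c * N i) = c * typeExponent N := by
  simp only [typeExponent, ← Finset.mul_sum, Real.negMulLog_mul, Finset.sum_add_distrib, mul_sub]
  rw [← Finset.sum_mul]
  ring

lemma continuous_typeExponent {S : Type*} [Fintype S] : Continuous (typeExponent (S := S)) := by
  unfold typeExponent
  fun_prop

section TypeClass

variable {ι κ S : Type*} [Fintype ι] [DecidableEq S]

/-- The number of occurrences of each symbol in a word. -/
def wordType (f : ι → S) (i : S) : ℕ := #{j | f j = i}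

lemma card_fiber_eq_wordType (f : ι → S) (i : S) : Fintype.card {j // f j = i} = wordType f i := by
  rw [Fintype.card_subtype, wordType]

/-- Bijections carrying the word `f` to the word `g` are families of bijections of fibres. -/
def equivCarryEquiv (f : ι → S) (g : κ → S) :
    {τ : ι ≃ κ // ∀ j, g (τ j) = f j} ≃ ∀ i, ({j // f j = i} ≃ {j // g j = i}) where
  toFun τ i := τ.1.subtypeEquiv fun j => by rw [τ.2 j]
  invFun e := ⟨Equiv.ofFiberEquiv e, Equiv.ofFiberEquiv_map e⟩
  left_inv τ := by
    ext j
    rfl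
  right_inv e := by
    ext i ⟨j, rfl⟩
    rfl

lemma card_equiv_carry [Fintype S] [Fintype κ] [DecidableEq ι] [DecidableEq κ] (f : ι → S) (g : κ → S) (h : wordType f = wordType g) :
    Fintype.card {τ : ι ≃ κ // ∀ j, g (τ j) = f j} = ∏ i, (wordType f i).factorial := by
  rw [Fintype.card_congr (equivCarryEquiv f g), Fintype.card_pi]
  refine Finset.prod_congr rfl fun i _ => ?_
  have e : Fintype.card {j // f j = i} = Fintype.card {j // g j = i} := by
    rw [card_fiber_eq_wordType, card_fiber_eq_wordType, h]
  rw [Fintype.card_equiv (Fintype.equivOfCardEq e), card_fiber_eq_wordType]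

lemma sum_wordType [Fintype S] (f : ι → S) : ∑ i, wordType f i = Fintype.card ι := by
  simp only [wordType]
  rw [← Finset.card_eq_sum_card_fiberwise (fun _ _ => Finset.mem_coe.2 (Finset.mem_univ _))]
  rfl

lemma sum_comp_eq_sum_wordType [Fintype S] (f : ι → S) (u : S → ℕ) :
    ∑ j, u (f j) = ∑ i, wordType f i * u i := by
  rw [← Finset.sum_fiberwise (s := Finset.univ) (g := f)]
  refine Finset.sum_congr rfl fun i _ => ?_
  rw [Finset.sum_congr rfl (g := fun _ => u i)]
  · simp [wordType]
  · intro j hj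
    rw [(Finset.mem_filter.1 hj).2]

lemma exists_wordType_eq [Fintype S] (N : S → ℕ) (h : ∑ i, N i = Fintype.card ι) :
    ∃ f : ι → S, wordType f = N := by
  have hc : Fintype.card ι = Fintype.card (Σ i, Fin (N i)) := by simp [h]
  let e := Fintype.equivOfCardEq hc
  refine ⟨fun j => (e j).1, funext fun i => ?_⟩
  rw [← card_fiber_eq_wordType]
  have : Fintype.card {j // (e j).1 = i} = Fintype.card {x : Σ i, Fin (N i) // x.1 = i} :=
    Fintype.card_congr (e.subtypeEquiv fun j => Iff.rfl)
  rw [this, Fintype.card_congr (Equiv.sigmaSubtype i)]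
  simp

/-- Count the permutations `τ` by the word `f₀ ∘ τ`: each word of type `N` arises from `∏ (N i)!` of
them. -/
lemma card_typeClass_mul_prod_factorial [Fintype S] [DecidableEq ι] (N : S → ℕ) (h : ∑ i, N i = Fintype.card ι) :
    #{f : ι → S | wordType f = N} * ∏ i, (N i).factorial = (Fintype.card ι).factorial := by
  obtain ⟨f₀, hf₀⟩ := exists_wordType_eq N h
  have h1 : Fintype.card (ι ≃ ι) = ∑ f ∈ ({f : ι → S | wordType f = N} : Finset _),
      #{τ : ι ≃ ι | f₀ ∘ τ = f} := by
    rw [← Finset.card_univ]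
    refine Finset.card_eq_sum_card_fiberwise fun τ _ => ?_
    simp only [Finset.coe_filter, Finset.mem_univ, true_and, Set.mem_ofPred_eq]
    rw [← hf₀]
    funext i
    rw [← card_fiber_eq_wordType, ← card_fiber_eq_wordType]
    exact Fintype.card_congr (τ.subtypeEquiv fun j => Iff.rfl)
  rw [Fintype.card_equiv (Equiv.refl ι)] at h1
  rw [h1, Finset.card_eq_sum_ones, Finset.sum_mul]
  refine Finset.sum_congr rfl fun f hf => ?_
  have hf' : wordType f = N := (Finset.mem_filter.1 hf).2
  rw [one_mul, ← hf', ← card_equiv_carry f f₀ (hf'.trans hf₀.symm), Fintype.card_subtype]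
  congr 1
  ext τ
  simp [funext_iff]

/-- Expand `(∑ N i) ^ card ι` over all words: each word of type `N` contributes `∏ N i ^ N i`, and
the other terms are dropped. -/
lemma card_typeClass_mul_prod_pow_le [Fintype S] [DecidableEq ι] (N : S → ℕ) (h : ∑ i, N i = Fintype.card ι) :
    #{f : ι → S | wordType f = N} * ∏ i, N i ^ N i ≤ Fintype.card ι ^ Fintype.card ι := by
  have h1 : (∏ _j : ι, ∑ i, N i) = ∑ f : ι → S, ∏ j, N (f j) := by
    rw [Finset.prod_univ_sum]
    simp
  have h2 : (∏ _j : ι, ∑ i, N i) = Fintype.card ι ^ Fintype.card ι := by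
    rw [h]; simp
  rw [← h2, h1, Finset.card_eq_sum_ones, Finset.sum_mul]
  refine (Finset.sum_le_sum fun f hf => ?_).trans
    (Finset.sum_le_sum_of_subset (Finset.filter_subset _ _))
  have hf' : wordType f = N := (Finset.mem_filter.1 hf).2
  rw [one_mul, ← Finset.prod_fiberwise (s := Finset.univ) (g := f)]
  refine Finset.prod_le_prod' fun i _ => ?_
  rw [Finset.prod_congr rfl (g := fun _ => N i)]
  · rw [Finset.prod_const]
    exact le_of_eq (by rw [← hf']; rfl)
  · intro j hj
    rw [(Finset.mem_filter.1 hj).2]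

lemma card_typeClass_pos [Fintype S] [DecidableEq ι] (N : S → ℕ) (h : ∑ i, N i = Fintype.card ι) :
    0 < #{f : ι → S | wordType f = N} := by
  obtain ⟨f, hf⟩ := exists_wordType_eq N h
  exact Finset.card_pos.2 ⟨f, by simp [hf]⟩

lemma log_card_typeClass_le [Fintype S] [DecidableEq ι] (N : S → ℕ) (h : ∑ i, N i = Fintype.card ι) :
    log #{f : ι → S | wordType f = N} ≤ typeExponent fun i => (N i : ℝ) := by
  have h0 := card_typeClass_pos N h
  have h1 : ((#{f : ι → S | wordType f = N} : ℝ)) * ∏ i, (N i : ℝ) ^ N i ≤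
      (Fintype.card ι : ℝ) ^ Fintype.card ι := by
    exact_mod_cast card_typeClass_mul_prod_pow_le N h
  -- Symbols that do not occur are harmless because `0 ^ 0 = 1`.
  have hp : ∀ i, (0 : ℝ) < (N i : ℝ) ^ N i := fun i => by
    rcases Nat.eq_zero_or_pos (N i) with h | h
    · simp [h]
    · positivity
  have h2 := Real.log_le_log (mul_pos (by exact_mod_cast h0)
    (Finset.prod_pos fun i _ => hp i)) h1
  rw [Real.log_mul (by exact_mod_cast h0.ne') (Finset.prod_pos fun i _ => hp i).ne',
    Real.log_prod fun i _ => (hp i).ne', Real.log_pow] at h2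
  simp only [Real.log_pow] at h2
  have h3 : (∑ i, (N i : ℝ)) = Fintype.card ι := by exact_mod_cast h
  rw [typeExponent, h3]
  simp only [negMulLog, neg_mul, Finset.sum_neg_distrib]
  linarith

lemma le_log_card_typeClass [Fintype S] [DecidableEq ι] (N : S → ℕ) (h : ∑ i, N i = Fintype.card ι) :
    typeExponent (fun i => (N i : ℝ)) - Fintype.card S * (1 + 2 * log (Fintype.card ι + 1)) ≤
      log #{f : ι → S | wordType f = N} := by
  have h0 := card_typeClass_pos N h
  have h1 : ((#{f : ι → S | wordType f = N} : ℝ)) * ∏ i, ((N i).factorial : ℝ) =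
      (Fintype.card ι).factorial := by
    exact_mod_cast card_typeClass_mul_prod_factorial N h
  have hp : ∀ i, ((N i).factorial : ℝ) ≠ 0 := fun i => by exact_mod_cast (N i).factorial_ne_zero
  have h2 := congrArg log h1
  rw [Real.log_mul (by exact_mod_cast h0.ne') (Finset.prod_ne_zero_iff.2 fun i _ => hp i),
    Real.log_prod fun i _ => hp i] at h2
  have h3 : (∑ i, (N i : ℝ)) = Fintype.card ι := by exact_mod_cast h
  have h4 := mul_log_sub_le_log_factorial (Fintype.card ι)
  have h5 : ∑ i, log ((N i).factorial : ℝ) ≤ ∑ i, (N i * log (N i) - N i) +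
      Fintype.card S * (1 + 2 * log (Fintype.card ι + 1)) := by
    rw [← nsmul_eq_mul, ← Finset.card_univ, ← Finset.sum_const, ← Finset.sum_add_distrib]
    refine Finset.sum_le_sum fun i _ => (log_factorial_le (N i)).trans ?_
    have : N i ≤ Fintype.card ι := h ▸ Finset.single_le_sum (fun _ _ => Nat.zero_le _) (mem_univ i)
    have : (N i : ℝ) ≤ Fintype.card ι := by exact_mod_cast this
    have : log ((N i : ℝ) + 1) ≤ log (Fintype.card ι + 1) :=
      Real.log_le_log (by positivity) (by linarith)
    linarith
  rw [Finset.sum_sub_distrib, h3] at h5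
  rw [typeExponent, h3]
  simp only [negMulLog, neg_mul, Finset.sum_neg_distrib]
  linarith

lemma wordType_le_card (f : ι → S) (i : S) : wordType f i ≤ Fintype.card ι :=
  Finset.card_le_univ _

/-- The number of types is polynomial in the word length, so summing over types does not affect
exponential growth. -/
lemma card_image_wordType_le [Fintype S] (s : Finset (ι → S)) :
    #(s.image wordType) ≤ (Fintype.card ι + 1) ^ Fintype.card S := by
  have : s.image wordType ⊆ Fintype.piFinset fun _ => Finset.range (Fintype.card ι + 1) := by
    intro N hN
    obtain ⟨f, -, rfl⟩ := Finset.mem_image.1 hN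
    exact Fintype.mem_piFinset.2 fun i => Finset.mem_range.2
      (Nat.lt_succ_of_le (wordType_le_card f i))
  refine (Finset.card_le_card this).trans (le_of_eq ?_)
  rw [Fintype.card_piFinset]
  simp

end TypeClass

/-- The exponent of the binomial coefficient. -/
def chooseExponent (a b : ℝ) : ℝ := negMulLog b + negMulLog (a - b) - negMulLog a

lemma continuous_chooseExponent (a : ℝ) : Continuous (chooseExponent a) := by
  unfold chooseExponent
  fun_prop

lemma chooseExponent_smul (c a b : ℝ) :
    chooseExponent (c * a) (c * b) = c * chooseExponent a b := by
  simp only [chooseExponent, ← mul_sub, Real.negMulLog_mul]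
  ring

lemma chooseExponent_eq_binEntropy {a : ℝ} (ha : 0 < a) (b : ℝ) :
    chooseExponent a b = a * binEntropy (b / a) := by
  have h : chooseExponent a b = chooseExponent (a * 1) (a * (b / a)) := by
    rw [mul_one, mul_div_cancel₀ _ ha.ne']
  rw [h, chooseExponent_smul, chooseExponent, binEntropy_eq_negMulLog_add_negMulLog_one_sub]
  simp

/-- The binomial coefficient appears in one term of the expansion of `(e + (n - e)) ^ n`. -/
lemma log_choose_le {n e : ℕ} (he : e ≤ n) : log (n.choose e : ℝ) ≤ chooseExponent n e := by
  have hpos : ∀ m : ℕ, (0 : ℝ) < (m : ℝ) ^ m := fun m => by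
    rcases Nat.eq_zero_or_pos m with h | h
    · simp [h]
    · positivity
  have hc : (0 : ℝ) < n.choose e := by exact_mod_cast Nat.choose_pos he
  have h1 : (n.choose e : ℝ) * ((e : ℝ) ^ e * ((n - e : ℕ) : ℝ) ^ (n - e)) ≤ (n : ℝ) ^ n := by
    have h2 : (n : ℝ) ^ n = ((e : ℝ) + ((n - e : ℕ) : ℝ)) ^ n := by
      congr 1
      exact_mod_cast (Nat.add_sub_of_le he).symm
    rw [h2, add_pow]
    refine le_trans (le_of_eq ?_) (Finset.single_le_sum (f := fun m => (e : ℝ) ^ m *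
      ((n - e : ℕ) : ℝ) ^ (n - m) * (n.choose m : ℝ)) (fun _ _ => by positivity)
      (Finset.mem_range.2 (Nat.lt_succ_of_le he)))
    ring
  have h2 := Real.log_le_log (mul_pos hc (mul_pos (hpos e) (hpos _))) h1
  rw [Real.log_mul hc.ne' (mul_pos (hpos e) (hpos _)).ne', Real.log_mul (hpos e).ne' (hpos _).ne',
    Real.log_pow, Real.log_pow, Real.log_pow, Nat.cast_sub he] at h2
  simp only [chooseExponent, negMulLog]
  linarith

lemma le_log_choose {n e : ℕ} (he : e ≤ n) :
    chooseExponent n e - 2 * (1 + 2 * log (n + 1)) ≤ log (n.choose e : ℝ) := by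
  have hc : (n.choose e : ℝ) ≠ 0 := by exact_mod_cast (Nat.choose_pos he).ne'
  have hf : ∀ m : ℕ, (m.factorial : ℝ) ≠ 0 := fun m => by exact_mod_cast m.factorial_ne_zero
  have h1 : (n.choose e : ℝ) * e.factorial * (n - e).factorial = n.factorial := by
    exact_mod_cast Nat.choose_mul_factorial_mul_factorial he
  have h2 := congrArg log h1
  rw [Real.log_mul (mul_ne_zero hc (hf _)) (hf _), Real.log_mul hc (hf _)] at h2
  have h3 := mul_log_sub_le_log_factorial n
  have h4 := log_factorial_le e
  have h5 := log_factorial_le (n - e)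
  have h6 : (e : ℝ) ≤ n := by exact_mod_cast he
  rw [Nat.cast_sub he] at h5
  have h7 : log ((e : ℝ) + 1) ≤ log (n + 1) := Real.log_le_log (by positivity) (by linarith)
  have h8 : log ((n : ℝ) - e + 1) ≤ log (n + 1) :=
    Real.log_le_log (by linarith) (by have := Nat.cast_nonneg (α := ℝ) e; linarith)
  simp only [chooseExponent, negMulLog]
  linarith

/-! ### Exponential families -/

/-- Finitely many functionals that are not all nonpositive at any nonzero vector have exactly one
exponentially weighted combination that vanishes. -/
lemma existsUnique_sum_exp_smul_eq_zero {E S : Type*} [NormedAddCommGroup E] [NormedSpace ℝ E]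
    [FiniteDimensional ℝ E] [Fintype S] (w : S → E →L[ℝ] ℝ) (hw : ∀ d ≠ 0, ∃ a, 0 < w a d) :
    ∃! θ : E, ∑ a, exp (w a θ) • w a = 0 := by
  classical
  have hproper : ProperSpace E := FiniteDimensional.proper ℝ E
  refine existsUnique_of_exists_of_unique ?_ ?_
  · rcases subsingleton_or_nontrivial E with hE | hE
    · exact ⟨0, ContinuousLinearMap.ext fun d => by simp [Subsingleton.elim d 0]⟩
    obtain ⟨d₀, hd₀⟩ := exists_ne (0 : E)
    have hS : (Finset.univ : Finset S).Nonempty := ⟨(hw d₀ hd₀).choose, Finset.mem_univ _⟩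
    -- The largest functional is positive on the unit sphere, hence bounded below there by a
    -- positive constant. By homogeneity the sum of exponentials grows at least linearly, so it is
    -- coercive and has a minimizer.
    let m : E → ℝ := fun d => Finset.univ.sup' hS fun a => w a d
    have hm : Continuous m := Continuous.finset_sup'_apply hS fun a _ => (w a).continuous
    have hsph : (Metric.sphere (0 : E) 1).Nonempty := NormedSpace.sphere_nonempty.2 zero_le_one
    obtain ⟨d₁, hd₁, hmin⟩ := (isCompact_sphere (0 : E) 1).exists_isMinOn hsph hm.continuousOn
    have hδ : 0 < m d₁ := by
      obtain ⟨a, ha⟩ := hw d₁ (ne_zero_of_mem_unit_sphere ⟨d₁, hd₁⟩)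
      exact ha.trans_le (Finset.le_sup' (fun a => w a d₁) (Finset.mem_univ a))
    let F : E → ℝ := fun θ => ∑ a, exp (w a θ)
    have hF : Continuous F := by fun_prop
    have hlow : ∀ θ, m d₁ * ‖θ‖ ≤ F θ := by
      intro θ
      rcases eq_or_ne θ 0 with rfl | hθ
      · simp only [norm_zero, mul_zero]
        positivity
      have hn : 0 < ‖θ‖ := norm_pos_iff.2 hθ
      have h1 : m d₁ ≤ m (‖θ‖⁻¹ • θ) := hmin (by simp [norm_smul, hn.ne'])
      obtain ⟨a, -, ha⟩ := Finset.exists_mem_eq_sup' hS fun a => w a (‖θ‖⁻¹ • θ)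
      have h2 : m d₁ * ‖θ‖ ≤ w a θ := by
        have h3 : m d₁ ≤ w a (‖θ‖⁻¹ • θ) := h1.trans (le_of_eq ha)
        rw [map_smul, smul_eq_mul] at h3
        calc m d₁ * ‖θ‖ ≤ ‖θ‖⁻¹ * w a θ * ‖θ‖ := mul_le_mul_of_nonneg_right h3 hn.le
          _ = w a θ := by field_simp
      refine h2.trans (le_trans ?_ (Finset.single_le_sum (f := fun a => exp (w a θ))
        (fun _ _ => (exp_pos _).le) (Finset.mem_univ a)))
      linarith [add_one_le_exp (w a θ)]
    have hlim : Filter.Tendsto F (Filter.cocompact E) Filter.atTop :=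
      Filter.tendsto_atTop_mono hlow ((tendsto_norm_cocompact_atTop).const_mul_atTop hδ)
    obtain ⟨θ, hθ⟩ := hF.exists_forall_le hlim
    refine ⟨θ, ?_⟩
    -- The weighted combination is the derivative of `F`, which vanishes at the minimizer.
    have hd : HasFDerivAt F (∑ a, exp (w a θ) • w a) θ :=
      HasFDerivAt.fun_sum fun a _ => (w a).hasFDerivAt.exp
    exact IsLocalMin.hasFDerivAt_eq_zero (Filter.Eventually.of_forall hθ) hd
  · intro θ₁ θ₂ h₁ h₂
    by_contra hne
    have e₁ := congrArg (fun L : E →L[ℝ] ℝ => L (θ₂ - θ₁)) h₁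
    have e₂ := congrArg (fun L : E →L[ℝ] ℝ => L (θ₂ - θ₁)) h₂
    simp only [_root_.sum_apply, _root_.smul_apply, smul_eq_mul,
      _root_.zero_apply, map_sub] at e₁ e₂
    -- Uniqueness is strict monotonicity of the gradient: tested on `θ₂ - θ₁`, the difference of the
    -- two equations is a sum of nonnegative terms, and `hw` makes one of them positive.
    have hnn : ∀ a, 0 ≤ (exp (w a θ₂) - exp (w a θ₁)) * (w a θ₂ - w a θ₁) := by
      intro a
      rcases le_total (w a θ₁) (w a θ₂) with h | h
      · exact mul_nonneg (sub_nonneg.2 (exp_le_exp.2 h)) (sub_nonneg.2 h)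
      · exact mul_nonneg_of_nonpos_of_nonpos (sub_nonpos.2 (exp_le_exp.2 h)) (sub_nonpos.2 h)
    have hsum : ∑ a, (exp (w a θ₂) - exp (w a θ₁)) * (w a θ₂ - w a θ₁) = 0 := by
      simp only [sub_mul, mul_sub, Finset.sum_sub_distrib] at e₁ e₂ ⊢
      linarith
    obtain ⟨a, ha⟩ := hw (θ₂ - θ₁) (sub_ne_zero.2 (Ne.symm hne))
    rw [map_sub] at ha
    have := (Finset.sum_eq_zero_iff_of_nonneg fun a _ => hnn a).1 hsum a (Finset.mem_univ a)
    have h3 : 0 < (exp (w a θ₂) - exp (w a θ₁)) * (w a θ₂ - w a θ₁) :=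
      mul_pos (sub_pos.2 (exp_lt_exp.2 (sub_pos.1 ha))) ha
    exact h3.ne' this

/-- Gibbs' inequality term by term, from `log x ≤ x - 1`. Summed over two distributions of equal
mass, the right-hand sides cancel. -/
lemma negMulLog_add_mul_log_le {a b : ℝ} (ha : 0 ≤ a) (hb : 0 < b) :
    negMulLog a + a * log b ≤ b - a := by
  rcases ha.eq_or_lt with rfl | ha
  · simpa using hb.le
  have h := Real.log_le_sub_one_of_pos (div_pos hb ha)
  rw [Real.log_div hb.ne' ha.ne'] at h
  have h2 := mul_le_mul_of_nonneg_left h ha.le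
  rw [mul_sub, mul_sub, mul_div_cancel₀ _ ha.ne'] at h2
  simp only [negMulLog]
  linarith

/-- The exponentially tilted distribution of total mass `σ` maximizes the type exponent among the
distributions with the same mass and the same mean of `θ`. -/
lemma isGreatest_typeExponent_tilted {S : Type*} [Fintype S] [Nonempty S] (θ : S → ℝ) {σ b : ℝ}
    (hσ : 0 < σ) (C : Set (S → ℝ))
    (hC : ∀ t ∈ C, (∀ i, 0 ≤ t i) ∧ ∑ i, t i = σ ∧ ∑ i, t i * θ i = b)
    (ht : (fun i => σ * (exp (θ i) / ∑ j, exp (θ j))) ∈ C) :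
    IsGreatest (typeExponent '' C) (σ * log (∑ j, exp (θ j)) - b) := by
  set Z := ∑ j, exp (θ j) with hZ
  have hZp : 0 < Z := Finset.sum_pos (fun _ _ => exp_pos _) Finset.univ_nonempty
  have hlog : ∀ i, log (σ * (exp (θ i) / Z)) = log σ + θ i - log Z := fun i => by
    rw [Real.log_mul hσ.ne' (by positivity), Real.log_div (exp_pos _).ne' hZp.ne', Real.log_exp]
    ring
  -- The logarithm of the tilted density is affine in `θ`, so its mean is the same for all members
  -- of `C`; Gibbs' inequality then compares every member with the tilted one.
  have key : ∀ t ∈ C, ∑ i, t i * log (σ * (exp (θ i) / Z)) = σ * log σ + b - σ * log Z := by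
    intro t h
    obtain ⟨-, h2, h3⟩ := hC t h
    simp only [hlog, mul_sub, mul_add, Finset.sum_sub_distrib, Finset.sum_add_distrib,
      ← Finset.sum_mul, h2, h3]
  refine ⟨⟨_, ht, ?_⟩, ?_⟩
  · have h1 := key _ ht
    simp only [typeExponent, (hC _ ht).2.1]
    simp only [negMulLog, neg_mul, Finset.sum_neg_distrib] at h1 ⊢
    linarith
  · rintro _ ⟨t, h, rfl⟩
    have h1 := key t h
    obtain ⟨h2, h3, -⟩ := hC t h
    have h4 := Finset.sum_le_sum fun i (_ : i ∈ Finset.univ) =>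
      negMulLog_add_mul_log_le (h2 i) (show 0 < σ * (exp (θ i) / Z) by positivity)
    rw [Finset.sum_add_distrib, h1, Finset.sum_sub_distrib, h3, (hC _ ht).2.1] at h4
    rw [typeExponent, h3]
    simp only [negMulLog] at h4 ⊢
    linarith

/-! ### Maxima over slices of compact convex sets -/

section Slice

variable {E : Type*} [NormedAddCommGroup E] [NormedSpace ℝ E]

/-- The supremum of `φ` on the part of `K` where `ℓ` has the value `β`. -/
def sliceSup (K : Set E) (ℓ : E →L[ℝ] ℝ) (φ : E → ℝ) (β : ℝ) : ℝ :=
  sSup (φ '' {x ∈ K | ℓ x = β})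

lemma isCompact_slice {K : Set E} (hK : IsCompact K) (ℓ : E →L[ℝ] ℝ) (β : ℝ) :
    IsCompact {x ∈ K | ℓ x = β} :=
  hK.inter_right (isClosed_eq ℓ.continuous continuous_const)

lemma isGreatest_sliceSup {K : Set E} (hK : IsCompact K) (ℓ : E →L[ℝ] ℝ) {φ : E → ℝ}
    (hφ : Continuous φ) {β : ℝ} (hβ : β ∈ ℓ '' K) :
    IsGreatest (φ '' {x ∈ K | ℓ x = β}) (sliceSup K ℓ φ β) := by
  obtain ⟨x, hx, rfl⟩ := hβ
  exact ((isCompact_slice hK ℓ _).image hφ).isGreatest_sSup ⟨_, x, ⟨hx, rfl⟩, rfl⟩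

/-- Near `x₀` the segment to `x₁` meets the slices with `φ` still above `c`; this gives lower
semicontinuity on the side of `x₁`. -/
lemma eventually_lt_sliceSup_of_segment {K : Set E} (hK : IsCompact K) (hc : Convex ℝ K)
    (ℓ : E →L[ℝ] ℝ) {φ : E → ℝ} (hφ : Continuous φ) {x₀ x₁ : E} (h₀ : x₀ ∈ K) (h₁ : x₁ ∈ K)
    {c : ℝ} (hcφ : c < φ x₀) :
    ∀ᶠ β in nhds (ℓ x₀), β ∈ Set.uIcc (ℓ x₀) (ℓ x₁) → c < sliceSup K ℓ φ β := by
  rcases eq_or_ne (ℓ x₁) (ℓ x₀) with he | he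
  · refine Filter.Eventually.of_forall fun β hβ => ?_
    rw [he, Set.uIcc_self, Set.mem_singleton_iff] at hβ
    subst hβ
    exact hcφ.trans_le ((isGreatest_sliceSup hK ℓ hφ ⟨x₀, h₀, rfl⟩).2 ⟨x₀, ⟨h₀, rfl⟩, rfl⟩)
  -- The parameter at which `ℓ` takes the value `β` on the line through `x₀` and `x₁`.
  let τ : ℝ → ℝ := fun β => (β - ℓ x₀) / (ℓ x₁ - ℓ x₀)
  have hτ : Continuous fun β => φ (x₀ + τ β • (x₁ - x₀)) := by fun_prop
  have hev : ∀ᶠ β in nhds (ℓ x₀), c < φ (x₀ + τ β • (x₁ - x₀)) := by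
    refine (hτ.tendsto (ℓ x₀)).eventually_const_lt ?_
    simpa [τ] using hcφ
  filter_upwards [hev] with β hβ hmem
  have hd : ℓ x₁ - ℓ x₀ ≠ 0 := sub_ne_zero.2 he
  have hτ01 : τ β ∈ Set.Icc (0 : ℝ) 1 := by
    rcases lt_or_gt_of_ne he with h | h
    · rw [Set.uIcc_of_ge h.le] at hmem
      have : ℓ x₁ - ℓ x₀ < 0 := by linarith
      exact ⟨div_nonneg_of_nonpos (by linarith [hmem.2]) this.le,
        (div_le_one_of_neg this).2 (by linarith [hmem.1])⟩
    · rw [Set.uIcc_of_le h.le] at hmem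
      have : 0 < ℓ x₁ - ℓ x₀ := by linarith
      exact ⟨div_nonneg (by linarith [hmem.1]) this.le,
        (div_le_one this).2 (by linarith [hmem.2])⟩
  have hx : x₀ + τ β • (x₁ - x₀) ∈ K := hc.add_smul_sub_mem h₀ h₁ hτ01
  have hℓ : ℓ (x₀ + τ β • (x₁ - x₀)) = β := by
    simp only [map_add, map_smul, map_sub, smul_eq_mul, τ]
    field_simp
    ring
  exact hβ.trans_le ((isGreatest_sliceSup hK ℓ hφ ⟨_, hx, hℓ⟩).2 ⟨_, ⟨hx, hℓ⟩, rfl⟩)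

/-- Lower semicontinuity follows from segments towards a minimizer and a maximizer of `ℓ` on `K`,
which cover both sides of `β₀`. For upper semicontinuity, the values of `ℓ` on the part of `K` where
`φ ≥ c` form a compact set that misses `β₀`. -/
lemma continuousOn_sliceSup {K : Set E} (hK : IsCompact K) (hc : Convex ℝ K)
    (ℓ : E →L[ℝ] ℝ) {φ : E → ℝ} (hφ : Continuous φ) :
    ContinuousOn (sliceSup K ℓ φ) (ℓ '' K) := by
  intro β₀ hβ₀
  obtain ⟨x₀, ⟨h₀, rfl⟩, hx₀⟩ := (isGreatest_sliceSup hK ℓ hφ hβ₀).1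
  refine tendsto_order.2 ⟨fun c hcφ => ?_, fun c hcφ => ?_⟩
  · rw [← hx₀] at hcφ
    obtain ⟨xm, hxm, hmin⟩ := hK.exists_isMinOn ⟨x₀, h₀⟩ ℓ.continuous.continuousOn
    obtain ⟨xM, hxM, hmax⟩ := hK.exists_isMaxOn ⟨x₀, h₀⟩ ℓ.continuous.continuousOn
    rw [eventually_nhdsWithin_iff]
    filter_upwards [eventually_lt_sliceSup_of_segment hK hc ℓ hφ h₀ hxm hcφ,
      eventually_lt_sliceSup_of_segment hK hc ℓ hφ h₀ hxM hcφ] with β h1 h2 hβ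
    obtain ⟨x, hx, rfl⟩ := hβ
    rcases le_total (ℓ x) (ℓ x₀) with h | h
    · exact h1 (Set.mem_uIcc_of_ge (hmin hx) h)
    · exact h2 (Set.mem_uIcc_of_le h (hmax hx))
  · have hC : IsCompact (ℓ '' (K ∩ φ ⁻¹' Set.Ici c)) :=
      (hK.inter_right (isClosed_Ici.preimage hφ)).image ℓ.continuous
    have hn : ℓ x₀ ∉ ℓ '' (K ∩ φ ⁻¹' Set.Ici c) := by
      rintro ⟨x, ⟨hx, hxc⟩, hxe⟩
      have := (isGreatest_sliceSup hK ℓ hφ hβ₀).2 ⟨x, ⟨hx, hxe⟩, rfl⟩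
      exact absurd (hcφ.trans_le hxc) (not_lt.2 this)
    rw [eventually_nhdsWithin_iff]
    filter_upwards [hC.isClosed.isOpen_compl.mem_nhds hn] with β h1 hβ
    obtain ⟨x, ⟨hx, hxe⟩, hxφ⟩ := (isGreatest_sliceSup hK ℓ hφ hβ).1
    rw [← hxφ]
    by_contra hlt
    exact h1 ⟨x, ⟨hx, not_lt.1 hlt⟩, hxe⟩

end Slice

/-! ### Integer points near real ones -/

/-- Real solutions of a homogeneous system with integer coefficients are at bounded distance from
integer solutions with no larger support. -/
lemma exists_int_kernel_near {D J : Type*} [Fintype D] [Fintype J] (M : D → J → ℤ) :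
    ∃ R : ℝ, ∀ x : J → ℝ, (∀ d, ∑ j, (M d j : ℝ) * x j = 0) →
      ∃ κ : J → ℤ, (∀ d, ∑ j, M d j * κ j = 0) ∧ (∀ j, x j = 0 → κ j = 0) ∧
        ∀ j, |(κ j : ℝ) - x j| ≤ R := by
  classical
  let b : D → ℤ := fun d => ∑ j, |M d j|
  -- Rounding a real solution down leaves a residual bounded by the absolute row sums, so only
  -- finitely many pairs of a residual and a support occur.
  let T : Finset ((D → ℤ) × Finset J) :=
    (Fintype.piFinset fun d => Finset.Icc (-b d) (b d)) ×ˢ Finset.univ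
  let Sol : (D → ℤ) × Finset J → (J → ℤ) → Prop := fun h g =>
    (∀ d, ∑ j, M d j * g j = h.1 d) ∧ ∀ j ∉ h.2, g j = 0
  -- One integer vector with the given residual and support is fixed per pair. Subtracting it from
  -- the rounded solution restores the equations at a uniformly bounded cost.
  let rep : (D → ℤ) × Finset J → J → ℤ := fun h => if H : ∃ g, Sol h g then H.choose else 0
  have hrep : ∀ h g, Sol h g → Sol h (rep h) := fun h g hg => by
    have H : ∃ g, Sol h g := ⟨g, hg⟩
    simp only [rep, dif_pos H]
    exact H.choose_spec
  refine ⟨1 + ∑ h ∈ T, ∑ j, |(rep h j : ℝ)|, fun x hx => ?_⟩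
  let fl : J → ℤ := fun j => ⌊x j⌋
  let h : (D → ℤ) × Finset J := (fun d => ∑ j, M d j * fl j, Finset.univ.filter fun j => x j ≠ 0)
  have hfl : Sol h fl := ⟨fun d => rfl, fun j hj => by
    have : x j = 0 := by simpa [h] using hj
    simp [fl, this]⟩
  have hr := hrep h fl hfl
  have hT : h ∈ T := by
    refine Finset.mem_product.2 ⟨Fintype.mem_piFinset.2 fun d => Finset.mem_Icc.2 ?_,
      Finset.mem_univ _⟩
    rw [← abs_le]
    have e1 : ((∑ j, M d j * fl j : ℤ) : ℝ) = -∑ j, (M d j : ℝ) * Int.fract (x j) := by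
      push_cast
      rw [eq_neg_iff_add_eq_zero, ← Finset.sum_add_distrib, ← hx d]
      refine Finset.sum_congr rfl fun j _ => ?_
      rw [← mul_add, Int.floor_add_fract]
    have e2 : |((∑ j, M d j * fl j : ℤ) : ℝ)| ≤ ((b d : ℤ) : ℝ) := by
      rw [e1, abs_neg]
      refine (Finset.abs_sum_le_sum_abs _ _).trans ?_
      push_cast [b]
      refine Finset.sum_le_sum fun j _ => ?_
      rw [abs_mul, abs_of_nonneg (Int.fract_nonneg (x j))]
      exact mul_le_of_le_one_right (abs_nonneg _) (Int.fract_lt_one _).le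
    exact_mod_cast e2
  refine ⟨fun j => fl j - rep h j, fun d => ?_, fun j hj => ?_, fun j => ?_⟩
  · simp only [mul_sub, Finset.sum_sub_distrib, hr.1 d, hfl.1 d, sub_self]
  · have : j ∉ h.2 := by simp [h, hj]
    change fl j - rep h j = 0
    rw [hfl.2 j this, hr.2 j this, sub_zero]
  · have e1 : |(rep h j : ℝ)| ≤ ∑ h ∈ T, ∑ j, |(rep h j : ℝ)| :=
      (Finset.single_le_sum (f := fun j => |(rep h j : ℝ)|) (fun _ _ => abs_nonneg _)
        (Finset.mem_univ j)).trans
      (Finset.single_le_sum (f := fun h => ∑ j, |(rep h j : ℝ)|)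
        (fun _ _ => Finset.sum_nonneg fun _ _ => abs_nonneg _) hT)
    have e2 : |(⌊x j⌋ : ℝ) - x j| ≤ 1 := by
      rw [abs_sub_comm, Int.self_sub_floor, abs_of_nonneg (Int.fract_nonneg _)]
      exact (Int.fract_lt_one _).le
    push_cast
    calc |(fl j : ℝ) - rep h j - x j| = |((⌊x j⌋ : ℝ) - x j) - rep h j| := by
          congr 1; simp only [fl]; ring
      _ ≤ |(⌊x j⌋ : ℝ) - x j| + |(rep h j : ℝ)| := abs_sub _ _
      _ ≤ _ := by linarith

/-- A convex set of nonnegative vectors has a member of maximal support. -/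
lemma exists_maximal_support {J : Type*} [Finite J] {P : Set (J → ℝ)} (hP : Convex ℝ P)
    (h0 : ∀ r ∈ P, ∀ j, 0 ≤ r j) (hne : P.Nonempty) :
    ∃ r ∈ P, ∀ r' ∈ P, ∀ j, 0 < r' j → 0 < r j := by
  classical
  have := Fintype.ofFinite J
  suffices H : ∀ s : Finset J, ∃ r ∈ P, ∀ j ∈ s, ∀ r' ∈ P, 0 < r' j → 0 < r j by
    obtain ⟨r, hr, h⟩ := H Finset.univ
    exact ⟨r, hr, fun r' hr' j => h j (Finset.mem_univ j) r' hr'⟩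
  intro s
  induction s using Finset.induction_on with
  | empty =>
    obtain ⟨r, hr⟩ := hne
    exact ⟨r, hr, by simp⟩
  | insert i s _ ih =>
    obtain ⟨r, hr, h⟩ := ih
    by_cases hi : ∃ r' ∈ P, 0 < r' i
    · obtain ⟨r₁, hr₁, hi⟩ := hi
      -- The midpoint of two nonnegative vectors is supported on the union of their supports.
      refine ⟨(1 / 2 : ℝ) • r + (1 / 2 : ℝ) • r₁,
        hP hr hr₁ (by norm_num) (by norm_num) (by norm_num), fun j hj r' hr' hpos => ?_⟩
      simp only [Pi.add_apply, Pi.smul_apply, smul_eq_mul]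
      rcases Finset.mem_insert.1 hj with rfl | hj
      · linarith [h0 r hr j]
      · linarith [h j hj r' hr' hpos, h0 r₁ hr₁ j]
    · refine ⟨r, hr, fun j hj r' hr' hpos => ?_⟩
      rcases Finset.mem_insert.1 hj with rfl | hj
      · exact absurd ⟨r', hr', hpos⟩ hi
      · exact h j hj r' hr' hpos

/-! ### Words and weights -/

lemma ioCoeff_eq_card {k q : ℕ} (G : Matrix (Fin k) (Fin q) (ZMod 2)) (u v : ℕ) :
    ioCoeff G u v = #{a : Fin k → ZMod 2 | hammingNorm a = u ∧
      hammingNorm (Matrix.vecMul a G) = v} := by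
  rw [ioCoeff, Nat.card_eq_fintype_card, Fintype.card_subtype]

lemma ioWef_eq_sum {k q : ℕ} (G : Matrix (Fin k) (Fin q) (ZMod 2)) (x y : ℝ) :
    ioWef G x y =
      ∑ a : Fin k → ZMod 2, x ^ hammingNorm a * y ^ hammingNorm (Matrix.vecMul a G) := by
  have hmaps : ∀ a ∈ (Finset.univ : Finset (Fin k → ZMod 2)),
      (hammingNorm a, hammingNorm (Matrix.vecMul a G)) ∈
        Finset.range (k + 1) ×ˢ Finset.range (q + 1) := fun a _ => by
    have h1 := hammingNorm_le_card_fintype (x := a)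
    have h2 := hammingNorm_le_card_fintype (x := Matrix.vecMul a G)
    simp only [Fintype.card_fin] at h1 h2
    exact Finset.mem_product.2 ⟨Finset.mem_range.2 (by lia), Finset.mem_range.2 (by lia)⟩
  rw [← Finset.sum_fiberwise_of_maps_to hmaps, Finset.sum_product, ioWef]
  refine Finset.sum_congr rfl fun u _ => Finset.sum_congr rfl fun v _ => ?_
  rw [Finset.sum_congr rfl (g := fun _ => x ^ u * y ^ v)]
  · rw [Finset.sum_const, nsmul_eq_mul, ioCoeff_eq_card, mul_assoc]
    simp only [Prod.mk.injEq]
  · intro a ha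
    have := (Finset.mem_filter.1 ha).2
    simp only [Prod.mk.injEq] at this
    rw [this.1, this.2]

namespace StronglyRegularEnsemble

variable {k q s : ℕ} (𝓜 : StronglyRegularEnsemble k q s)

instance : Fintype 𝓜.cnRep := Fintype.ofFinite _

/-- The weight of the local codeword of a VN with input word `a`. -/
def outWeight (a : Fin k → ZMod 2) : ℕ := hammingNorm (Matrix.vecMul a 𝓜.vnRep)

lemma outWeight_le (a : Fin k → ZMod 2) : 𝓜.outWeight a ≤ q := by
  simpa [outWeight] using hammingNorm_le_card_fintype (x := Matrix.vecMul a 𝓜.vnRep)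

lemma outWeight_zero : 𝓜.outWeight 0 = 0 := by simp [outWeight]

/-- Full rank makes the encoding injective. -/
lemma outWeight_pos {a : Fin k → ZMod 2} (ha : a ≠ 0) : 0 < 𝓜.outWeight a := by
  refine hammingNorm_pos_iff.2 fun h => ha ?_
  have hinj := Matrix.vecMul_injective_iff.2 𝓜.vnRep_linearIndependent
  exact hinj (by simpa using h)

lemma B_eq_sum (x y : ℝ) :
    𝓜.B x y = ∑ a : Fin k → ZMod 2, x ^ hammingNorm a * y ^ 𝓜.outWeight a :=
  ioWef_eq_sum _ x y

lemma wefCoeff_eq_card (u : ℕ) :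
    wefCoeff 𝓜.cnRep u = #{c : 𝓜.cnRep | hammingNorm c.1 = u} := by
  rw [wefCoeff, ← Fintype.card_subtype, ← Nat.card_eq_fintype_card]
  exact Nat.card_congr (Equiv.subtypeSubtypeEquivSubtypeInter (fun c => c ∈ 𝓜.cnRep)
    (fun c => hammingNorm c = u)).symm

lemma A_eq_sum (z : ℝ) : 𝓜.A z = ∑ c : 𝓜.cnRep, z ^ hammingNorm c.1 := by
  have hmaps : ∀ c ∈ (Finset.univ : Finset 𝓜.cnRep), hammingNorm c.1 ∈ Finset.range (s + 1) :=
    fun c _ => by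
      have h1 := hammingNorm_le_card_fintype (x := c.1)
      simp only [Fintype.card_fin] at h1
      exact Finset.mem_range.2 (by lia)
  rw [← Finset.sum_fiberwise_of_maps_to hmaps, A, wef]
  refine Finset.sum_congr rfl fun u _ => ?_
  rw [Finset.sum_congr rfl (g := fun _ => z ^ u)]
  · rw [Finset.sum_const, nsmul_eq_mul, wefCoeff_eq_card]
  · intro c hc
    rw [(Finset.mem_filter.1 hc).2]

lemma exists_cnRep_ne_zero : ∃ c : 𝓜.cnRep, c.1 ≠ 0 := by
  obtain ⟨c, hc, h0⟩ := (Submodule.ne_bot_iff _).1 𝓜.cnRep_ne_bot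
  exact ⟨⟨c, hc⟩, h0⟩

lemma s_pos (𝓜 : StronglyRegularEnsemble k q s) : 0 < s := by
  obtain ⟨c, hc⟩ := 𝓜.exists_cnRep_ne_zero
  rcases Nat.eq_zero_or_pos s with rfl | h
  · exact absurd (Subsingleton.elim c.1 0) hc
  · exact h

lemma q_pos (𝓜 : StronglyRegularEnsemble k q s) (hk : 0 < k) : 0 < q := by
  have h : (1 : Fin k → ZMod 2) ≠ 0 := fun h => one_ne_zero (congrFun h ⟨0, hk⟩)
  exact (𝓜.outWeight_pos h).trans_le (𝓜.outWeight_le 1)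

lemma setOf_wefCoeff_pos :
    {u | 0 < wefCoeff 𝓜.cnRep u} = Set.range fun c : 𝓜.cnRep => hammingNorm c.1 := by
  ext u
  simp only [Set.mem_ofPred_eq, Set.mem_range]
  rw [wefCoeff_eq_card, Finset.card_pos]
  simp [Finset.Nonempty]

lemma hammingNorm_le_cnMaxWeight (c : 𝓜.cnRep) : hammingNorm c.1 ≤ 𝓜.cnMaxWeight := by
  rw [cnMaxWeight, setOf_wefCoeff_pos]
  exact le_csSup (Set.finite_range _).bddAbove ⟨c, rfl⟩

lemma exists_hammingNorm_eq_cnMaxWeight : ∃ c : 𝓜.cnRep, hammingNorm c.1 = 𝓜.cnMaxWeight := by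
  rw [cnMaxWeight, setOf_wefCoeff_pos]
  exact Nat.sSup_mem (Set.range_nonempty _) (Set.finite_range _).bddAbove

/-! ### Averaging over the edge permutation -/

/-- The word sent along the edges by the VNs. -/
def edgeWord (n : ℕ) (a : Fin n → Fin k → ZMod 2) (e : Fin n × Fin q) : ZMod 2 :=
  Matrix.vecMul (a e.1) (𝓜.vn n e.1) e.2

lemma hammingNorm_prod {ι κ : Type*} [Fintype ι] [Fintype κ] (x : ι × κ → ZMod 2) :
    hammingNorm x = ∑ i, hammingNorm fun e => x (i, e) := by
  simp only [hammingNorm, Finset.card_filter]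
  rw [Fintype.sum_prod_type]

lemma wordType_one {ι : Type*} [Fintype ι] (x : ι → ZMod 2) : wordType x 1 = hammingNorm x := by
  rw [wordType, hammingNorm]
  congr 1
  ext j
  have : ∀ b : ZMod 2, b = 1 ↔ b ≠ 0 := by decide
  simp [this]

lemma wordType_zero_add {ι : Type*} [Fintype ι] (x : ι → ZMod 2) :
    wordType x 0 + hammingNorm x = Fintype.card ι := by
  rw [← wordType_one, ← sum_wordType x]
  exact (Fin.sum_univ_two (wordType x)).symm

/-- The type of a binary word is determined by its length and weight, so the general fibrewise count
reduces to two factorials. -/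
lemma card_equiv_carry_binary {ι κ : Type*} [Fintype ι] [Fintype κ] [DecidableEq ι]
    [DecidableEq κ] (h : Fintype.card ι = Fintype.card κ) (x : ι → ZMod 2) (y : κ → ZMod 2) :
    #{τ : ι ≃ κ | ∀ j, y (τ j) = x j} = if hammingNorm x = hammingNorm y then
      (hammingNorm x).factorial * (Fintype.card ι - hammingNorm x).factorial else 0 := by
  split_ifs with hxy
  · have h0 : wordType x 0 = wordType y 0 := by
      have h1 := wordType_zero_add x
      have h2 := wordType_zero_add y
      lia
    have hT : wordType x = wordType y := by
      funext i
      have : ∀ b : ZMod 2, b = 0 ∨ b = 1 := by decide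
      rcases this i with rfl | rfl
      · exact h0
      · rw [wordType_one, wordType_one, hxy]
    rw [← Fintype.card_subtype, card_equiv_carry x y hT]
    refine (Fin.prod_univ_two fun i : ZMod 2 => (wordType x i).factorial).trans ?_
    have h1 := wordType_zero_add x
    change (wordType x 0).factorial * (wordType x 1).factorial = _
    rw [wordType_one, mul_comm]
    congr 2
    lia
  · rw [Finset.card_eq_zero, Finset.filter_eq_empty_iff]
    intro τ _ hτ
    refine hxy ?_
    rw [← wordType_one, ← wordType_one, ← card_fiber_eq_wordType, ← card_fiber_eq_wordType]
    exact Fintype.card_congr (τ.subtypeEquiv fun j => by rw [hτ j])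

/-- Under a uniform bijection the image of `x` is uniform on the words of the same weight, so each
of them has probability one over the binomial coefficient. -/
lemma sum_weighted_equiv {ι κ : Type*} [Fintype ι] [Fintype κ] [DecidableEq ι]
    [DecidableEq κ] (h : Fintype.card ι = Fintype.card κ) (x : ι → ZMod 2)
    (Q : (κ → ZMod 2) → Prop) [DecidablePred Q] :
    (#{τ : ι ≃ κ | Q fun e => x (τ.symm e)} : ℝ) / Fintype.card (ι ≃ κ) =
      ∑ y : κ → ZMod 2, if Q y ∧ hammingNorm x = hammingNorm y then
        ((Fintype.card ι).choose (hammingNorm x) : ℝ)⁻¹ else 0 := by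
  have hle : hammingNorm x ≤ Fintype.card ι := hammingNorm_le_card_fintype
  have h1 : #{τ : ι ≃ κ | Q fun e => x (τ.symm e)} =
      ∑ y : κ → ZMod 2 with Q y, #{τ : ι ≃ κ | ∀ j, y (τ j) = x j} := by
    rw [Finset.card_eq_sum_card_fiberwise (t := ({y : κ → ZMod 2 | Q y} : Finset _))
      (f := fun τ : ι ≃ κ => fun e => x (τ.symm e)) fun τ hτ => by simpa using hτ]
    refine Finset.sum_congr rfl fun y hy => ?_
    congr 1
    ext τ
    simp only [Finset.mem_filter, Finset.mem_univ, true_and] at hy ⊢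
    constructor
    · rintro ⟨-, rfl⟩ j
      simp
    · intro hτ
      have : (fun e => x (τ.symm e)) = y := funext fun e => by simp [← hτ]
      exact ⟨this ▸ hy, this⟩
  rw [h1, Fintype.card_equiv (Fintype.equivOfCardEq h), Nat.cast_sum, Finset.sum_div,
    Finset.sum_filter]
  refine Finset.sum_congr rfl fun y _ => ?_
  rw [card_equiv_carry_binary h, ite_and]
  split_ifs
  · have h2 := Nat.choose_mul_factorial_mul_factorial hle
    rw [← h2]
    have hc : ((Fintype.card ι).choose (hammingNorm x) : ℝ) ≠ 0 := by
      exact_mod_cast (Nat.choose_pos hle).ne'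
    have hf : ∀ m : ℕ, (m.factorial : ℝ) ≠ 0 := fun m => by exact_mod_cast m.factorial_ne_zero
    have := hf (hammingNorm x)
    have := hf (Fintype.card ι - hammingNorm x)
    push_cast
    field_simp
  · simp
  · rfl

/-- Words of two finite sets with equally distributed statistics correspond to each other. -/
lemma exists_equiv_of_card_fiber_eq {α β γ : Type*} [Finite α] [Finite β] (f : α → γ) (g : β → γ)
    (h : ∀ c, Nat.card {a // f a = c} = Nat.card {b // g b = c}) :
    ∃ e : α ≃ β, ∀ a, g (e a) = f a := by
  have := fun c => (Finite.card_eq.1 (h c))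
  exact ⟨Equiv.ofFiberEquiv fun c => (this c).some, Equiv.ofFiberEquiv_map _⟩

/-- Only weights enter the count, so a weight-preserving relabelling of input words, not necessarily
linear, replaces every VN by the reference VN. -/
lemma exists_vn_equiv (n : ℕ) (j : Fin n) : ∃ e : (Fin k → ZMod 2) ≃ (Fin k → ZMod 2),
    ∀ a, hammingNorm (e a) = hammingNorm a ∧
      hammingNorm (Matrix.vecMul (e a) (𝓜.vn n j)) = 𝓜.outWeight a := by
  obtain ⟨e, he⟩ := exists_equiv_of_card_fiber_eq
    (fun a : Fin k → ZMod 2 => (hammingNorm a, 𝓜.outWeight a))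
    (fun a : Fin k → ZMod 2 => (hammingNorm a, hammingNorm (Matrix.vecMul a (𝓜.vn n j))))
    (fun c => by
      have := 𝓜.vn_type n j c.1 c.2
      simpa only [ioCoeff, Prod.ext_iff, outWeight] using this.symm)
  exact ⟨e, fun a => by simpa using he a⟩

lemma exists_cn_equiv (n : ℕ) (i : Fin (n * q / s)) : ∃ e : 𝓜.cnRep ≃ 𝓜.cn n i,
    ∀ c, hammingNorm (e c).1 = hammingNorm c.1 := by
  have hc : ∀ (C : Submodule (ZMod 2) (Fin s → ZMod 2)) (u : ℕ),
      Nat.card {c : C // hammingNorm c.1 = u} = wefCoeff C u := fun C u =>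
    Nat.card_congr (Equiv.subtypeSubtypeEquivSubtypeInter (fun c => c ∈ C)
      (fun c => hammingNorm c = u))
  exact exists_equiv_of_card_fiber_eq (fun c : 𝓜.cnRep => hammingNorm c.1)
    (fun c : 𝓜.cn n i => hammingNorm c.1) fun u => by rw [hc, hc, 𝓜.cn_type n i u]

/-- The pairs of tuples of VN input words and CN codewords of the reference nodes with total input
weight `w` and with equal weights at the two ends of the edges. -/
def wordPairs (n w : ℕ) : Finset ((Fin n → Fin k → ZMod 2) × (Fin (n * q / s) → 𝓜.cnRep)) :=
  {p | ∑ j, hammingNorm (p.1 j) = w ∧ ∑ j, 𝓜.outWeight (p.1 j) = ∑ i, hammingNorm (p.2 i).1}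

/-- Exchange the sum over permutations with the sum over input words, average over the permutation
for each input, and relabel all nodes to the reference nodes. -/
lemma expNumCodewords_eq_sum_choose {n : ℕ} (w : ℕ) (hn : s ∣ n * q) :
    𝓜.expNumCodewords n w =
      ∑ p ∈ 𝓜.wordPairs n w, ((n * q).choose (∑ j, 𝓜.outWeight (p.1 j)) : ℝ)⁻¹ := by
  classical
  have hcard : Fintype.card (Fin n × Fin q) = Fintype.card (Fin (n * q / s) × Fin s) := by
    simp [Nat.div_mul_cancel hn]
  have hcard' : Fintype.card (Fin n × Fin q) = n * q := by simp
  let Q : (Fin (n * q / s) × Fin s → ZMod 2) → Prop := fun y => ∀ i, (fun e => y (i, e)) ∈ 𝓜.cn n i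
  have h1 : 𝓜.expNumCodewords n w = ∑ a : Fin n → Fin k → ZMod 2,
      if ∑ j, hammingNorm (a j) = w then
        (#{τ : 𝓜.Member n | Q fun e => 𝓜.edgeWord n a (τ.symm e)} : ℝ) /
          Fintype.card (𝓜.Member n) else 0 := by
    rw [expNumCodewords, ← Finset.sum_filter, ← Finset.sum_div]
    congr 1
    simp only [Finset.card_filter]
    push_cast
    rw [Finset.sum_comm]
    refine Finset.sum_congr rfl fun τ _ => ?_
    rw [numCodewords, Nat.card_eq_fintype_card, Fintype.card_subtype, Finset.sum_filter,
      Finset.card_filter]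
    push_cast
    refine Finset.sum_congr rfl fun a _ => ?_
    rw [← ite_and]
    refine if_congr ?_ rfl rfl
    rw [and_comm]
    rfl
  have h2 : ∀ a : Fin n → Fin k → ZMod 2,
      (#{τ : 𝓜.Member n | Q fun e => 𝓜.edgeWord n a (τ.symm e)} : ℝ) /
          Fintype.card (𝓜.Member n) =
        ∑ y : (i : Fin (n * q / s)) → 𝓜.cn n i,
          if hammingNorm (𝓜.edgeWord n a) = ∑ i, hammingNorm (y i).1 then
            ((n * q).choose (hammingNorm (𝓜.edgeWord n a)) : ℝ)⁻¹ else 0 := by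
    intro a
    have h3 := sum_weighted_equiv hcard (𝓜.edgeWord n a) Q
    rw [hcard'] at h3
    refine h3.trans ?_
    simp only [ite_and]
    rw [← Finset.sum_filter]
    symm
    -- Words accepted by all CNs are the same as tuples of local codewords.
    refine Finset.sum_bij (fun y _ => fun e => (y e.1).1 e.2) ?_ ?_ ?_ ?_
    · intro y _
      simp only [Finset.mem_filter, Finset.mem_univ, true_and]
      exact fun i => (y i).2
    · intro y _ y' _ h
      funext i
      ext e
      exact congrFun h (i, e)
    · intro y hy
      simp only [Finset.mem_filter, Finset.mem_univ, true_and] at hy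
      exact ⟨fun i => ⟨_, hy i⟩, Finset.mem_univ _, rfl⟩
    · intro y _
      rw [hammingNorm_prod fun e : Fin (n * q / s) × Fin s => (y e.1).1 e.2]
  choose eV hV using 𝓜.exists_vn_equiv n
  choose eC hC using 𝓜.exists_cn_equiv n
  rw [h1, wordPairs, Finset.sum_filter, Fintype.sum_prod_type]
  rw [← Equiv.sum_comp (Equiv.piCongrRight eV)]
  refine Finset.sum_congr rfl fun a _ => ?_
  have e1 : ∑ j, hammingNorm (Equiv.piCongrRight eV a j) = ∑ j, hammingNorm (a j) :=
    Finset.sum_congr rfl fun j _ => (hV j (a j)).1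
  have e2 : hammingNorm (𝓜.edgeWord n (Equiv.piCongrRight eV a)) = ∑ j, 𝓜.outWeight (a j) := by
    rw [hammingNorm_prod]
    exact Finset.sum_congr rfl fun j _ => (hV j (a j)).2
  rw [e1, h2, e2, ← Equiv.sum_comp (Equiv.piCongrRight eC)]
  simp only [ite_and]
  split_ifs with hw
  · refine Finset.sum_congr rfl fun y _ => ?_
    have e3 : ∑ i, hammingNorm (Equiv.piCongrRight eC y i).1 = ∑ i, hammingNorm (y i).1 :=
      Finset.sum_congr rfl fun i _ => hC i (y i)
    rw [e3]
  · simp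

/-! ### Joint types of VN and CN words -/

/-- The local words of the reference VN and of the reference CN. -/
abbrev Letter : Type := (Fin k → ZMod 2) ⊕ 𝓜.cnRep

/-- `N` is the joint type of VN and CN words that agree in weight at the two ends of the edges, for
`n` VNs and total input weight `w`. -/
structure IsCompat (n w : ℕ) (N : 𝓜.Letter → ℕ) : Prop where
  vn : ∑ a, N (.inl a) = n
  cn : (∑ c, N (.inr c)) * s = n * q
  input : ∑ a, N (.inl a) * hammingNorm a = w
  edge : ∑ a, N (.inl a) * 𝓜.outWeight a = ∑ c, N (.inr c) * hammingNorm c.1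

/-- The exponent of the contribution of a joint type to the expected number of codewords. -/
def exponent (r : 𝓜.Letter → ℝ) : ℝ :=
  typeExponent (fun a => r (.inl a)) + typeExponent (fun c => r (.inr c)) -
    chooseExponent q (∑ a, r (.inl a) * 𝓜.outWeight a)

lemma continuous_exponent : Continuous 𝓜.exponent := by
  have h1 : Continuous fun r : 𝓜.Letter → ℝ => typeExponent fun a => r (.inl a) :=
    continuous_typeExponent.comp (by fun_prop)
  have h2 : Continuous fun r : 𝓜.Letter → ℝ => typeExponent fun c => r (.inr c) :=
    continuous_typeExponent.comp (by fun_prop)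
  have h3 : Continuous fun r : 𝓜.Letter → ℝ =>
      chooseExponent q (∑ a, r (.inl a) * 𝓜.outWeight a) :=
    (continuous_chooseExponent q).comp (by fun_prop)
  exact (h1.add h2).sub h3

/-- A bound for the logarithms of the polynomial factors. -/
def logError (n : ℕ) : ℝ :=
  (Fintype.card (Fin k → ZMod 2) + Fintype.card 𝓜.cnRep + 2) * (1 + 2 * log (n * q + 1))

variable {𝓜}

lemma IsCompat.dvd {n w : ℕ} {N : 𝓜.Letter → ℕ} (h : 𝓜.IsCompat n w N) : s ∣ n * q :=
  ⟨_, by rw [← h.cn, mul_comm]⟩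

lemma IsCompat.cn' {n w : ℕ} {N : 𝓜.Letter → ℕ} (h : 𝓜.IsCompat n w N) :
    ∑ c, N (.inr c) = n * q / s := by
  rw [← h.cn, Nat.mul_div_cancel _ 𝓜.s_pos]

lemma IsCompat.outWeight_le {n w : ℕ} {N : 𝓜.Letter → ℕ} (h : 𝓜.IsCompat n w N) :
    ∑ a, N (.inl a) * 𝓜.outWeight a ≤ n * q := by
  rw [← h.vn, Finset.sum_mul]
  exact Finset.sum_le_sum fun a _ => Nat.mul_le_mul_left _ (𝓜.outWeight_le a)

lemma mul_exponent_div {n : ℕ} (hn : 0 < n) (N : 𝓜.Letter → ℕ) :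
    n * 𝓜.exponent (fun j => (N j : ℝ) / n) =
      typeExponent (fun a => (N (.inl a) : ℝ)) + typeExponent (fun c => (N (.inr c) : ℝ)) -
        chooseExponent (n * q : ℕ) (∑ a, N (.inl a) * 𝓜.outWeight a : ℕ) := by
  have hn' : (n : ℝ) ≠ 0 := by exact_mod_cast hn.ne'
  rw [exponent, mul_sub, mul_add, ← typeExponent_smul, ← typeExponent_smul, ← chooseExponent_smul,
    Finset.mul_sum]
  push_cast
  have e1 : ∀ j, (n : ℝ) * (N j / n) = N j := fun j => by field_simp
  have e2 : ∀ a, (n : ℝ) * (N (.inl a) / n * 𝓜.outWeight a) = N (.inl a) * 𝓜.outWeight a :=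
    fun a => by field_simp
  simp only [e1, e2]

/-- The joint type of a pair of tuples of words. -/
def pairType {n m : ℕ} (p : (Fin n → Fin k → ZMod 2) × (Fin m → 𝓜.cnRep)) : 𝓜.Letter → ℕ :=
  Sum.elim (wordType p.1) (wordType p.2)

lemma mem_wordPairs_iff {n w : ℕ} (hn : s ∣ n * q)
    (p : (Fin n → Fin k → ZMod 2) × (Fin (n * q / s) → 𝓜.cnRep)) :
    p ∈ 𝓜.wordPairs n w ↔ 𝓜.IsCompat n w (pairType p) := by
  have h1 := sum_comp_eq_sum_wordType p.1 hammingNorm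
  have h2 := sum_comp_eq_sum_wordType p.1 𝓜.outWeight
  have h3 := sum_comp_eq_sum_wordType p.2 fun c => hammingNorm c.1
  have h4 := sum_wordType p.1
  have h5 := sum_wordType p.2
  rw [Fintype.card_fin] at h4 h5
  simp only [wordPairs, Finset.mem_filter, Finset.mem_univ, true_and]
  rw [h1, h2, h3]
  constructor
  · rintro ⟨e1, e2⟩
    exact ⟨h4, by simpa [pairType, h5] using Nat.div_mul_cancel hn, e1, e2⟩
  · rintro ⟨-, -, e1, e2⟩
    exact ⟨e1, e2⟩

lemma sum_wordPairs_of_type {n w : ℕ} {N : 𝓜.Letter → ℕ} (h : 𝓜.IsCompat n w N) :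
    ∑ p ∈ 𝓜.wordPairs n w with pairType p = N,
      ((n * q).choose (∑ j, 𝓜.outWeight (p.1 j)) : ℝ)⁻¹ =
    #{f : Fin n → Fin k → ZMod 2 | wordType f = fun a => N (.inl a)} *
      #{f : Fin (n * q / s) → 𝓜.cnRep | wordType f = fun c => N (.inr c)} *
      ((n * q).choose (∑ a, N (.inl a) * 𝓜.outWeight a) : ℝ)⁻¹ := by
  rw [Finset.sum_congr rfl
    (g := fun _ => ((n * q).choose (∑ a, N (.inl a) * 𝓜.outWeight a) : ℝ)⁻¹)]
  · rw [Finset.sum_const, nsmul_eq_mul, ← Nat.cast_mul, ← Finset.card_product]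
    congr 3
    ext p
    have hN : pairType p = N ↔
        (wordType p.1 = fun a => N (.inl a)) ∧ wordType p.2 = fun c => N (.inr c) := by
      simp [funext_iff, pairType]
    simp only [Finset.mem_filter, Finset.mem_product, Finset.mem_univ, true_and]
    rw [mem_wordPairs_iff h.dvd, ← hN]
    exact ⟨fun hp => hp.2, fun hp => ⟨hp ▸ h, hp⟩⟩
  · intro p hp
    rw [sum_comp_eq_sum_wordType p.1 𝓜.outWeight, ← (Finset.mem_filter.1 hp).2]
    rfl

lemma log_sum_wordPairs_of_type {n w : ℕ} {N : 𝓜.Letter → ℕ} (h : 𝓜.IsCompat n w N) :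
    0 < ∑ p ∈ 𝓜.wordPairs n w with pairType p = N,
      ((n * q).choose (∑ j, 𝓜.outWeight (p.1 j)) : ℝ)⁻¹ ∧
    log (∑ p ∈ 𝓜.wordPairs n w with pairType p = N,
      ((n * q).choose (∑ j, 𝓜.outWeight (p.1 j)) : ℝ)⁻¹) =
    log #{f : Fin n → Fin k → ZMod 2 | wordType f = fun a => N (.inl a)} +
      log #{f : Fin (n * q / s) → 𝓜.cnRep | wordType f = fun c => N (.inr c)} -
      log ((n * q).choose (∑ a, N (.inl a) * 𝓜.outWeight a)) := by
  have h1 : (0 : ℝ) < #{f : Fin n → Fin k → ZMod 2 | wordType f = fun a => N (.inl a)} := by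
    exact_mod_cast card_typeClass_pos (ι := Fin n) (fun a => N (.inl a)) (by simpa using h.vn)
  have h2 : (0 : ℝ) < #{f : Fin (n * q / s) → 𝓜.cnRep | wordType f = fun c => N (.inr c)} := by
    exact_mod_cast card_typeClass_pos (ι := Fin (n * q / s)) (fun a => N (.inr a))
      (by simpa using h.cn')
  have h3 : (0 : ℝ) < (n * q).choose (∑ a, N (.inl a) * 𝓜.outWeight a) := by
    exact_mod_cast Nat.choose_pos h.outWeight_le
  rw [sum_wordPairs_of_type h]
  refine ⟨by positivity, ?_⟩
  rw [Real.log_mul (by positivity) (by positivity), Real.log_mul h1.ne' h2.ne', Real.log_inv]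
  ring

lemma natCast_le_mul_q (𝓜 : StronglyRegularEnsemble k q s) (hk : 0 < k) (n : ℕ) : (n : ℝ) ≤ n * q := by
  have : (1 : ℝ) ≤ q := by exact_mod_cast 𝓜.q_pos hk
  nlinarith [Nat.cast_nonneg (α := ℝ) n]

/-- All summands are nonnegative, so the contribution of a single type is a lower bound. -/
lemma le_log_expNumCodewords (hk : 0 < k) {n w : ℕ} (hn : 0 < n) {N : 𝓜.Letter → ℕ}
    (h : 𝓜.IsCompat n w N) : 0 < 𝓜.expNumCodewords n w ∧
      n * 𝓜.exponent (fun j => (N j : ℝ) / n) - 𝓜.logError n ≤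
        log (𝓜.expNumCodewords n w) := by
  obtain ⟨h1, h2⟩ := log_sum_wordPairs_of_type h
  have h3 : ∑ p ∈ 𝓜.wordPairs n w with pairType p = N,
      ((n * q).choose (∑ j, 𝓜.outWeight (p.1 j)) : ℝ)⁻¹ ≤ 𝓜.expNumCodewords n w := by
    rw [expNumCodewords_eq_sum_choose 𝓜 w h.dvd]
    exact Finset.sum_le_sum_of_subset_of_nonneg (Finset.filter_subset _ _)
      fun _ _ _ => by positivity
  refine ⟨h1.trans_le h3, le_trans ?_ (Real.log_le_log h1 h3)⟩
  rw [h2, mul_exponent_div hn, logError]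
  have e1 := le_log_card_typeClass (ι := Fin n) (fun a => N (.inl a)) (by simpa using h.vn)
  have e2 := le_log_card_typeClass (ι := Fin (n * q / s)) (fun c => N (.inr c))
    (by simpa using h.cn')
  have e3 := log_choose_le h.outWeight_le
  rw [Fintype.card_fin] at e1 e2
  have l1 : log ((n : ℝ) + 1) ≤ log (n * q + 1) :=
    Real.log_le_log (by positivity) (by linarith [𝓜.natCast_le_mul_q hk n])
  have l2 : log (((n * q / s : ℕ) : ℝ) + 1) ≤ log (n * q + 1) := by
    refine Real.log_le_log (by positivity) ?_
    have : ((n * q / s : ℕ) : ℝ) ≤ (n * q : ℕ) := by exact_mod_cast Nat.div_le_self _ _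
    push_cast at this
    linarith
  have l3 : 0 ≤ log ((n : ℝ) * q + 1) := Real.log_nonneg (by
    have : (0 : ℝ) ≤ n * q := by positivity
    linarith)
  have m1 := mul_le_mul_of_nonneg_left l1
    (Nat.cast_nonneg (α := ℝ) (Fintype.card (Fin k → ZMod 2)))
  have m2 := mul_le_mul_of_nonneg_left l2 (Nat.cast_nonneg (α := ℝ) (Fintype.card 𝓜.cnRep))
  nlinarith

lemma exists_isCompat_of_pos {n w : ℕ} (hn : s ∣ n * q) (h : 0 < 𝓜.expNumCodewords n w) :
    ∃ N, 𝓜.IsCompat n w N := by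
  rw [expNumCodewords_eq_sum_choose 𝓜 w hn] at h
  obtain ⟨p, hp⟩ := Finset.nonempty_of_sum_ne_zero h.ne'
  exact ⟨_, (mem_wordPairs_iff hn p).1 hp⟩

/-- The expectation is at most the number of types times the largest contribution of a type. -/
lemma log_expNumCodewords_le (hk : 0 < k) {n w : ℕ} (hn : 0 < n) (hd : s ∣ n * q)
    (hpos : 0 < 𝓜.expNumCodewords n w) {b : ℝ}
    (hb : ∀ N, 𝓜.IsCompat n w N → 𝓜.exponent (fun j => (N j : ℝ) / n) ≤ b) :
    log (𝓜.expNumCodewords n w) ≤ n * b + 𝓜.logError n := by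
  set T := (𝓜.wordPairs n w).image pairType with hT
  -- The type-class bounds are free of error here; the added logarithm comes from the lower bound
  -- for the binomial coefficient in the denominator.
  have h1 : 𝓜.expNumCodewords n w ≤
      #T * exp (n * b + 2 * (1 + 2 * log (n * q + 1))) := by
    rw [expNumCodewords_eq_sum_choose 𝓜 w hd,
      ← Finset.sum_fiberwise_of_maps_to fun p hp => Finset.mem_image_of_mem pairType hp]
    rw [← nsmul_eq_mul]
    refine Finset.sum_le_card_nsmul _ _ _ fun N hN => ?_
    obtain ⟨p, hp, rfl⟩ := Finset.mem_image.1 hN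
    have hc := (mem_wordPairs_iff hd p).1 hp
    obtain ⟨h2, h3⟩ := log_sum_wordPairs_of_type hc
    rw [← Real.log_le_iff_le_exp h2, h3]
    have e1 := log_card_typeClass_le (ι := Fin n) (fun a => pairType p (.inl a))
      (by simpa using hc.vn)
    have e2 := log_card_typeClass_le (ι := Fin (n * q / s)) (fun c => pairType p (.inr c))
      (by simpa using hc.cn')
    have e3 := le_log_choose hc.outWeight_le
    have e4 := mul_exponent_div hn (pairType p)
    have e5 := mul_le_mul_of_nonneg_left (hb _ hc) (Nat.cast_nonneg (α := ℝ) n)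
    push_cast at e3 e4
    linarith
  have h2 : #T ≤ (n + 1) ^ Fintype.card (Fin k → ZMod 2) *
      (n * q / s + 1) ^ Fintype.card 𝓜.cnRep := by
    have hsub : T ⊆ (((Finset.univ : Finset (Fin n → Fin k → ZMod 2)).image wordType) ×ˢ
        ((Finset.univ : Finset (Fin (n * q / s) → 𝓜.cnRep)).image wordType)).image
        fun x => Sum.elim x.1 x.2 := by
      intro N hN
      obtain ⟨p, -, rfl⟩ := Finset.mem_image.1 hN
      exact Finset.mem_image.2 ⟨(wordType p.1, wordType p.2), Finset.mem_product.2
        ⟨Finset.mem_image_of_mem _ (Finset.mem_univ _),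
          Finset.mem_image_of_mem _ (Finset.mem_univ _)⟩, rfl⟩
    refine (Finset.card_le_card hsub).trans (Finset.card_image_le.trans ?_)
    rw [Finset.card_product]
    refine Nat.mul_le_mul ?_ ?_
    · simpa using card_image_wordType_le (Finset.univ : Finset (Fin n → Fin k → ZMod 2))
    · simpa using card_image_wordType_le (Finset.univ : Finset (Fin (n * q / s) → 𝓜.cnRep))
  have hT0 : (0 : ℝ) < #T := by
    by_contra h0
    have : (#T : ℝ) = 0 := le_antisymm (not_lt.1 h0) (Nat.cast_nonneg _)
    rw [this, zero_mul] at h1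
    linarith
  have h3 := Real.log_le_log hpos h1
  rw [Real.log_mul hT0.ne' (exp_pos _).ne', Real.log_exp] at h3
  have h4 : log (#T : ℝ) ≤ Fintype.card (Fin k → ZMod 2) * log ((n : ℝ) + 1) +
      Fintype.card 𝓜.cnRep * log (((n * q / s : ℕ) : ℝ) + 1) := by
    have := Real.log_le_log hT0 (show (#T : ℝ) ≤ ((n : ℝ) + 1) ^ Fintype.card (Fin k → ZMod 2) *
      (((n * q / s : ℕ) : ℝ) + 1) ^ Fintype.card 𝓜.cnRep by exact_mod_cast h2)
    rwa [Real.log_mul (by positivity) (by positivity), Real.log_pow, Real.log_pow] at this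
  have l1 : log ((n : ℝ) + 1) ≤ log (n * q + 1) :=
    Real.log_le_log (by positivity) (by linarith [𝓜.natCast_le_mul_q hk n])
  have l2 : log (((n * q / s : ℕ) : ℝ) + 1) ≤ log (n * q + 1) := by
    refine Real.log_le_log (by positivity) ?_
    have : ((n * q / s : ℕ) : ℝ) ≤ (n * q : ℕ) := by exact_mod_cast Nat.div_le_self _ _
    push_cast at this
    linarith
  have l3 : 0 ≤ log ((n : ℝ) * q + 1) := Real.log_nonneg (by
    have : (0 : ℝ) ≤ n * q := by positivity
    linarith)
  have m1 := mul_le_mul_of_nonneg_left l1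
    (Nat.cast_nonneg (α := ℝ) (Fintype.card (Fin k → ZMod 2)))
  have m2 := mul_le_mul_of_nonneg_left l2 (Nat.cast_nonneg (α := ℝ) (Fintype.card 𝓜.cnRep))
  have m3 := mul_nonneg (Nat.cast_nonneg (α := ℝ) (Fintype.card (Fin k → ZMod 2))) l3
  have m4 := mul_nonneg (Nat.cast_nonneg (α := ℝ) (Fintype.card 𝓜.cnRep)) l3
  have m5 := Nat.cast_nonneg (α := ℝ) (Fintype.card (Fin k → ZMod 2))
  have m6 := Nat.cast_nonneg (α := ℝ) (Fintype.card 𝓜.cnRep)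
  rw [logError]
  nlinarith

lemma tendsto_logError_div (hk : 0 < k) :
    Filter.Tendsto (fun n : ℕ => 𝓜.logError n / n) Filter.atTop (nhds 0) := by
  have hq : (0 : ℝ) < q := by exact_mod_cast 𝓜.q_pos hk
  have hx : Filter.Tendsto (fun n : ℕ => (n : ℝ) * q + 1) Filter.atTop Filter.atTop :=
    Filter.tendsto_atTop_add_const_right _ _ (tendsto_natCast_atTop_atTop.atTop_mul_const hq)
  have h1 : Filter.Tendsto (fun n : ℕ => log ((n : ℝ) * q + 1) / (1 * ((n : ℝ) * q + 1) + (-1)))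
      Filter.atTop (nhds 0) := by
    refine ((Real.tendsto_pow_log_div_mul_add_atTop 1 (-1) 1 one_ne_zero).comp hx).congr fun n => ?_
    simp only [Function.comp_apply, pow_one]
  have h2 : Filter.Tendsto (fun n : ℕ => ((n : ℝ))⁻¹) Filter.atTop (nhds 0) :=
    tendsto_inv_atTop_nhds_zero_nat
  have h3 := ((h1.const_mul (2 * (q : ℝ))).add h2).const_mul
    (Fintype.card (Fin k → ZMod 2) + Fintype.card 𝓜.cnRep + 2 : ℝ)
  simp only [mul_zero, add_zero] at h3
  refine h3.congr fun n => ?_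
  rw [logError]
  rcases Nat.eq_zero_or_pos n with rfl | hn
  · simp
  have : (0 : ℝ) < n := by exact_mod_cast hn
  have e : 1 * ((n : ℝ) * q + 1) + -1 = n * q := by ring
  rw [e]
  field_simp
  ring

variable (𝓜)

/-! ### The polytope of limiting joint types -/

/-- The mean input weight. -/
def inputMean (r : 𝓜.Letter → ℝ) : ℝ := ∑ a, r (.inl a) * hammingNorm a

/-- The limits of normalized joint types. -/
def typeSpace : Set (𝓜.Letter → ℝ) :=
  {r | (∀ j, 0 ≤ r j) ∧ ∑ a, r (.inl a) = 1 ∧ ∑ c, r (.inr c) = q / s ∧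
    ∑ a, r (.inl a) * 𝓜.outWeight a = ∑ c, r (.inr c) * hammingNorm c.1}

/-- The limits of normalized joint types with mean input weight `α`. -/
def typePolytope (α : ℝ) : Set (𝓜.Letter → ℝ) := {r ∈ 𝓜.typeSpace | 𝓜.inputMean r = α}

lemma continuous_inputMean : Continuous 𝓜.inputMean := by
  unfold inputMean
  fun_prop

lemma isCompact_typeSpace : IsCompact 𝓜.typeSpace := by
  have hc : IsClosed 𝓜.typeSpace := by
    have h1 : IsClosed {r : 𝓜.Letter → ℝ | ∀ j, 0 ≤ r j} := by
      rw [Set.ofPred_forall]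
      exact isClosed_iInter fun j => isClosed_le continuous_const (continuous_apply j)
    have h2 : IsClosed {r : 𝓜.Letter → ℝ | ∑ a, r (.inl a) = 1} :=
      isClosed_eq (by fun_prop) continuous_const
    have h3 : IsClosed {r : 𝓜.Letter → ℝ | ∑ c, r (.inr c) = q / s} :=
      isClosed_eq (by fun_prop) continuous_const
    have h4 : IsClosed {r : 𝓜.Letter → ℝ | ∑ a, r (.inl a) * 𝓜.outWeight a =
        ∑ c, r (.inr c) * hammingNorm c.1} :=
      isClosed_eq (by fun_prop) (by fun_prop)
    exact h1.inter (h2.inter (h3.inter h4))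
  refine IsCompact.of_isClosed_subset
    (isCompact_univ_pi fun _ : 𝓜.Letter => isCompact_Icc (a := (0 : ℝ)) (b := 1 + q / s)) hc ?_
  rintro r ⟨h0, h1, h2, -⟩ j -
  refine ⟨h0 j, ?_⟩
  have hq : (0 : ℝ) ≤ q / s := by positivity
  rcases j with a | c
  · have := Finset.single_le_sum (f := fun a => r (.inl a)) (fun _ _ => h0 _) (mem_univ a)
    simp only [h1] at this
    linarith
  · have := Finset.single_le_sum (f := fun c => r (.inr c)) (fun _ _ => h0 _) (mem_univ c)
    simp only [h2] at this
    linarith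

lemma isCompact_typePolytope (α : ℝ) : IsCompact (𝓜.typePolytope α) :=
  𝓜.isCompact_typeSpace.inter_right (isClosed_eq 𝓜.continuous_inputMean continuous_const)

lemma convex_typePolytope (α : ℝ) : Convex ℝ (𝓜.typePolytope α) := by
  rintro r ⟨⟨h0, h1, h2, h3⟩, h4⟩ r' ⟨⟨h0', h1', h2', h3'⟩, h4'⟩ a b ha hb hab
  rw [inputMean] at h4 h4'
  refine ⟨⟨fun j => ?_, ?_, ?_, ?_⟩, ?_⟩
  · exact add_nonneg (mul_nonneg ha (h0 j)) (mul_nonneg hb (h0' j))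
  all_goals
    simp only [inputMean, Pi.add_apply, Pi.smul_apply, smul_eq_mul, add_mul, mul_assoc,
      Finset.sum_add_distrib, ← Finset.mul_sum, h1, h2, h3, h4, h1', h2', h3', h4']
  all_goals rw [← add_mul, hab, one_mul]

variable {𝓜}

/-- The mean input weight is `w / n`, which only tends to `α`; this is why `typeSpace` is kept apart
from `typePolytope α`. -/
lemma IsCompat.div_mem_typeSpace {n w : ℕ} (hn : 0 < n) {N : 𝓜.Letter → ℕ}
    (h : 𝓜.IsCompat n w N) : (fun j => (N j : ℝ) / n) ∈ 𝓜.typeSpace ∧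
      𝓜.inputMean (fun j => (N j : ℝ) / n) = (w : ℝ) / n := by
  have hn' : (n : ℝ) ≠ 0 := by exact_mod_cast hn.ne'
  have hs : (s : ℝ) ≠ 0 := by exact_mod_cast 𝓜.s_pos.ne'
  have h1 : ∑ a, (N (.inl a) : ℝ) = n := by exact_mod_cast h.vn
  have h2 : (∑ c, (N (.inr c) : ℝ)) * s = n * q := by exact_mod_cast h.cn
  have h3 : ∑ a, (N (.inl a) : ℝ) * hammingNorm a = w := by exact_mod_cast h.input
  have h4 : ∑ a, (N (.inl a) : ℝ) * 𝓜.outWeight a = ∑ c, (N (.inr c) : ℝ) * hammingNorm c.1 := by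
    exact_mod_cast h.edge
  refine ⟨⟨fun j => by positivity, ?_, ?_, ?_⟩, ?_⟩
  · rw [← Finset.sum_div, h1, div_self hn']
  · rw [← Finset.sum_div]
    field_simp
    exact h2
  · simp only [div_mul_eq_mul_div, ← Finset.sum_div, h4]
  · simp only [inputMean, div_mul_eq_mul_div, ← Finset.sum_div, h3]

/-! ### Normalized joint types and their limits -/

lemma eventually_fst_weightFilter (𝓜 : StronglyRegularEnsemble k q s) (α : ℝ) {p : ℕ → Prop}
    (h : ∀ᶠ n in atTop, p n) : ∀ᶠ x in 𝓜.weightFilter α, p x.1 :=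
  Filter.Eventually.filter_mono (inf_le_left.trans inf_le_left) (tendsto_comap.eventually h)

lemma eventually_div_weightFilter (𝓜 : StronglyRegularEnsemble k q s) (α : ℝ) {O : Set ℝ}
    (h : O ∈ 𝓝 α) : ∀ᶠ x in 𝓜.weightFilter α, (x.2 : ℝ) / x.1 ∈ O :=
  Filter.Eventually.filter_mono (inf_le_left.trans inf_le_right) (tendsto_comap.eventually h)

lemma eventually_dvd_weightFilter (𝓜 : StronglyRegularEnsemble k q s) (α : ℝ) :
    ∀ᶠ x in 𝓜.weightFilter α, s ∣ x.1 * q :=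
  Filter.Eventually.filter_mono inf_le_right (mem_principal_self _)

/-- The mean input weights attained on `typeSpace ∩ C` form a compact set that does not contain `α`,
so `w / n` eventually avoids it. -/
lemma eventually_notMem_of_disjoint {α : ℝ} {C : Set (𝓜.Letter → ℝ)} (hC : IsClosed C)
    (hd : Disjoint C (𝓜.typePolytope α)) :
    ∀ᶠ x in 𝓜.weightFilter α, ∀ N, 𝓜.IsCompat x.1 x.2 N → (fun j => (N j : ℝ) / x.1) ∉ C := by
  have hK : IsClosed (𝓜.inputMean '' (𝓜.typeSpace ∩ C)) :=
    ((𝓜.isCompact_typeSpace.inter_right hC).image 𝓜.continuous_inputMean).isClosed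
  have hα : α ∉ 𝓜.inputMean '' (𝓜.typeSpace ∩ C) := by
    rintro ⟨r, ⟨h1, h2⟩, h3⟩
    exact Set.disjoint_left.1 hd h2 ⟨h1, h3⟩
  filter_upwards [𝓜.eventually_fst_weightFilter α (eventually_gt_atTop 0),
    𝓜.eventually_div_weightFilter α (hK.isOpen_compl.mem_nhds hα)] with x h1 h2 N hN hmem
  obtain ⟨h3, h4⟩ := hN.div_mem_typeSpace h1
  rw [← h4] at h2
  exact h2 ⟨_, ⟨h3, hmem⟩, rfl⟩

/-- Given a joint type, a nearby limiting type of maximal support is approximated by joint types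
with the same parameters. -/
lemma eventually_exists_isCompat_near {α : ℝ} {r : 𝓜.Letter → ℝ} (hr : r ∈ 𝓜.typePolytope α)
    (hmax : ∀ r' ∈ 𝓜.typePolytope α, ∀ j, 0 < r' j → 0 < r j) {ε : ℝ} (hε : 0 < ε) :
    ∀ᶠ x in 𝓜.weightFilter α, ∀ N, 𝓜.IsCompat x.1 x.2 N →
      ∃ N', 𝓜.IsCompat x.1 x.2 N' ∧ ∀ j, |(N' j : ℝ) / x.1 - r j| < ε := by
  classical
  -- Being below every positive entry of `r`, `δ` ensures that a perturbation smaller than `δ` keeps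
  -- those entries positive.
  obtain ⟨δ, ⟨hδr, hδε⟩, hδ⟩ : ∃ δ, ((∀ j, 0 < r j → δ < r j) ∧ δ < ε) ∧ 0 < δ := by
    have h1 : ∀ᶠ δ in 𝓝[>] (0 : ℝ), (∀ j, 0 < r j → δ < r j) ∧ δ < ε := by
      refine Filter.Eventually.and ?_ (nhdsWithin_le_nhds (eventually_lt_nhds hε))
      refine eventually_all.2 fun j => ?_
      by_cases hj : 0 < r j
      · filter_upwards [nhdsWithin_le_nhds (eventually_lt_nhds hj)] with δ h _ using h
      · exact Filter.Eventually.of_forall fun δ h => absurd h hj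
    exact (h1.and self_mem_nhdsWithin).exists
  -- The rows are the homogeneous parts of the four equations of `IsCompat`, so adding a kernel
  -- vector keeps `n` and `w`.
  let M : Fin 4 → 𝓜.Letter → ℤ := ![Sum.elim (fun _ => 1) (fun _ => 0),
    Sum.elim (fun _ => 0) (fun _ => 1), Sum.elim (fun a => hammingNorm a) (fun _ => 0),
    Sum.elim (fun a => 𝓜.outWeight a) (fun c => -(hammingNorm c.1 : ℤ))]
  obtain ⟨R, hR⟩ := exists_int_kernel_near M
  let C : Set (𝓜.Letter → ℝ) := {y | ∀ r' ∈ 𝓜.typePolytope α, δ / 2 ≤ dist y r'}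
  have hC : IsClosed C := by
    have : C = ⋂ r' ∈ 𝓜.typePolytope α, {y | δ / 2 ≤ dist y r'} := by
      ext y
      simp [C]
    rw [this]
    exact isClosed_biInter fun r' _ => isClosed_le continuous_const (by fun_prop)
  have hd : Disjoint C (𝓜.typePolytope α) := Set.disjoint_left.2 fun y hy hy' => by
    have := hy y hy'
    rw [dist_self] at this
    linarith
  have hlarge : ∀ᶠ n : ℕ in atTop, R / n < δ / 2 :=
    (tendsto_const_div_atTop_nhds_zero_nat R).eventually_lt_const (by linarith)
  filter_upwards [eventually_notMem_of_disjoint hC hd,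
    𝓜.eventually_fst_weightFilter α (eventually_gt_atTop 0),
    𝓜.eventually_fst_weightFilter α hlarge] with x hx hn hRn N hN
  have hnear := hx N hN
  simp only [C, Set.mem_ofPred_eq, not_forall, not_le] at hnear
  obtain ⟨r₁, hr₁, hdist⟩ := hnear
  have hn' : (0 : ℝ) < x.1 := by exact_mod_cast hn
  obtain ⟨⟨h0, h1, h2, h3⟩, h4⟩ := hr
  obtain ⟨⟨g0, g1, g2, g3⟩, g4⟩ := id hr₁
  rw [inputMean] at h4 g4
  -- `r₁` is a point of the polytope close to the normalized given type, so `r - r₁` satisfies the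
  -- homogeneous equations. Its multiple by `n` is rounded to an integer kernel vector.
  obtain ⟨κ, hκM, hκ0, hκR⟩ := hR (fun j => x.1 * (r j - r₁ j)) (by
    intro d
    simp only [Fintype.sum_sum_type]
    fin_cases d
    · simp [M, ← Finset.mul_sum, Finset.sum_sub_distrib, h1, g1]
    · simp [M, ← Finset.mul_sum, Finset.sum_sub_distrib, h2, g2]
    · have e : ∀ a : Fin k → ZMod 2, (hammingNorm a : ℝ) * (x.1 * (r (.inl a) - r₁ (.inl a))) =
          x.1 * (r (.inl a) * hammingNorm a - r₁ (.inl a) * hammingNorm a) := fun a => by ring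
      simp [M, e, ← Finset.mul_sum, Finset.sum_sub_distrib, h4, g4]
    · have e : ∀ a : Fin k → ZMod 2, (𝓜.outWeight a : ℝ) * (x.1 * (r (.inl a) - r₁ (.inl a))) =
          x.1 * (r (.inl a) * 𝓜.outWeight a - r₁ (.inl a) * 𝓜.outWeight a) := fun a => by ring
      have e' : ∀ c : 𝓜.cnRep, (hammingNorm c.1 : ℝ) * (x.1 * (r (.inr c) - r₁ (.inr c))) =
          x.1 * (r (.inr c) * hammingNorm c.1 - r₁ (.inr c) * hammingNorm c.1) :=
        fun a => by ring
      simp [M, e, e', ← Finset.mul_sum, Finset.sum_sub_distrib, h3, g3])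
  have hclose : ∀ j, |((N j + κ j : ℤ) : ℝ) / x.1 - r j| < δ := by
    intro j
    have e1 : ((N j + κ j : ℤ) : ℝ) / x.1 - r j =
        ((N j : ℝ) / x.1 - r₁ j) + (κ j - x.1 * (r j - r₁ j)) / x.1 := by
      push_cast
      field_simp
      ring
    have e2 : |(N j : ℝ) / x.1 - r₁ j| < δ / 2 := by
      refine lt_of_le_of_lt ?_ hdist
      rw [← Real.dist_eq]
      exact dist_le_pi_dist (fun j => (N j : ℝ) / x.1) r₁ j
    have e3 : |(κ j - x.1 * (r j - r₁ j)) / x.1| < δ / 2 := by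
      rw [abs_div, abs_of_pos hn']
      exact lt_of_le_of_lt (div_le_div_of_nonneg_right (hκR j) hn'.le) hRn
    rw [e1]
    exact (abs_add_le _ _).trans_lt (by linarith)
  -- Where `r` vanishes, maximality of its support makes `r₁` vanish as well, so the correction is
  -- zero there. Elsewhere the new entry is within `δ` of an entry of `r` that exceeds `δ`.
  have hnn : ∀ j, 0 ≤ (N j + κ j : ℤ) := by
    intro j
    rcases (h0 j).eq_or_lt with hj | hj
    · have h5 : r₁ j = 0 := by
        refine le_antisymm (not_lt.1 fun hlt => ?_) (g0 j)
        exact (hmax r₁ hr₁ j hlt).ne hj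
      rw [hκ0 j (by rw [← hj, h5]; simp), add_zero]
      exact Int.natCast_nonneg _
    · have h5 := (abs_lt.1 (hclose j)).1
      have h6 : 0 < ((N j + κ j : ℤ) : ℝ) / x.1 := by linarith [hδr j hj]
      have h7 : 0 < ((N j + κ j : ℤ) : ℝ) := by
        have := mul_pos h6 hn'
        rwa [div_mul_cancel₀ _ hn'.ne'] at this
      exact_mod_cast h7.le
  have hcast : ∀ j, (((N j + κ j).toNat : ℕ) : ℤ) = N j + κ j := fun j => Int.toNat_of_nonneg (hnn j)
  have k0 := hκM 0
  have k1 := hκM 1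
  have k2 := hκM 2
  have k3 := hκM 3
  simp only [Fintype.sum_sum_type] at k0 k1 k2 k3
  simp [M] at k0 k1 k2 k3
  refine ⟨fun j => (N j + κ j).toNat, ⟨?_, ?_, ?_, ?_⟩, fun j => ?_⟩
  · zify
    simp only [hcast, Finset.sum_add_distrib, k0, add_zero]
    exact_mod_cast hN.vn
  · zify
    simp only [hcast, Finset.sum_add_distrib, k1, add_zero]
    exact_mod_cast hN.cn
  · zify
    simp only [hcast, add_mul, Finset.sum_add_distrib]
    simp only [mul_comm (κ _), k2, add_zero]
    exact_mod_cast hN.input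
  · zify
    simp only [hcast, add_mul, Finset.sum_add_distrib]
    simp only [mul_comm (κ _)]
    have := hN.edge
    zify at this
    linarith
  · have := hclose j
    rw [← hcast j, Int.cast_natCast] at this
    exact this.trans hδε

/-- Limiting types are limits of normalized joint types that satisfy a given linear equation. -/
lemma exists_tendsto_isCompat {α : ℝ} {r : 𝓜.Letter → ℝ} (hr : r ∈ 𝓜.typePolytope α)
    (c : 𝓜.Letter → ℤ) (hc : ∑ j, (c j : ℝ) * r j = 0) :
    ∃ (N : ℕ → 𝓜.Letter → ℕ) (n w : ℕ → ℕ), (∀ᶠ m in atTop, 𝓜.IsCompat (n m) (w m) (N m)) ∧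
      (∀ᶠ m in atTop, ∑ j, c j * N m j = 0) ∧ Tendsto n atTop atTop ∧
      Tendsto (fun m => (w m : ℝ) / n m) atTop (𝓝 α) := by
  classical
  obtain ⟨⟨h0, h1, h2, h3⟩, h4⟩ := id hr
  rw [inputMean] at h4
  have hs : (s : ℝ) ≠ 0 := by exact_mod_cast 𝓜.s_pos.ne'
  -- Here `n` and `w` are not prescribed but read off from the counts. Eliminating them leaves the
  -- ratio of node numbers, the edge balance and the extra equation `c`, all homogeneous.
  let M : Fin 3 → 𝓜.Letter → ℤ := ![Sum.elim (fun _ => -(q : ℤ)) (fun _ => s),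
    Sum.elim (fun a => 𝓜.outWeight a) (fun c => -(hammingNorm c.1 : ℤ)), c]
  obtain ⟨R, hR⟩ := exists_int_kernel_near M
  have hker : ∀ m : ℕ, ∀ d, ∑ j, (M d j : ℝ) * (m * r j) = 0 := by
    intro m d
    have e : ∀ j, (M d j : ℝ) * (m * r j) = m * (M d j * r j) := fun j => by ring
    simp only [e, ← Finset.mul_sum]
    refine mul_eq_zero_of_right _ ?_
    fin_cases d
    · simp only [Fintype.sum_sum_type]
      simp [M, ← Finset.mul_sum, h1, h2]
      field_simp
      ring
    · simp only [Fintype.sum_sum_type]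
      simp [M]
      simp only [mul_comm (𝓜.outWeight _ : ℝ), mul_comm (hammingNorm _ : ℝ), h3]
      ring
    · exact hc
  -- Integer solutions at bounded distance from `m * r`, hence of the right proportions as `m`
  -- grows.
  choose κ hκM hκ0 hκR using fun m : ℕ => hR (fun j => m * r j) (hker m)
  have hκ : ∀ j, Tendsto (fun m : ℕ => (κ m j : ℝ) / m) atTop (𝓝 (r j)) := by
    intro j
    rw [tendsto_iff_dist_tendsto_zero]
    refine squeeze_zero' (Eventually.of_forall fun _ => dist_nonneg) ?_
      (tendsto_const_div_atTop_nhds_zero_nat R)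
    filter_upwards [eventually_gt_atTop 0] with m hm
    have hm' : (0 : ℝ) < m := by exact_mod_cast hm
    rw [Real.dist_eq, show (κ m j : ℝ) / m - r j = (κ m j - m * r j) / m by field_simp, abs_div,
      abs_of_pos hm']
    exact div_le_div_of_nonneg_right (hκR m j) hm'.le
  have hnn : ∀ᶠ m in atTop, ∀ j, 0 ≤ κ m j := by
    refine eventually_all.2 fun j => ?_
    rcases (h0 j).eq_or_lt with hj | hj
    · exact Eventually.of_forall fun m => (hκ0 m j (by rw [← hj, mul_zero])).ge
    · filter_upwards [(hκ j).eventually_const_lt hj, eventually_gt_atTop 0] with m hm hm0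
      have hm' : (0 : ℝ) < m := by exact_mod_cast hm0
      have : 0 < (κ m j : ℝ) := by
        have := mul_pos hm hm'
        rwa [div_mul_cancel₀ _ hm'.ne'] at this
      exact_mod_cast this.le
  let N : ℕ → 𝓜.Letter → ℕ := fun m j => (κ m j).toNat
  have hcast : ∀ᶠ m in atTop, ∀ j, (N m j : ℤ) = κ m j :=
    hnn.mono fun m hm j => Int.toNat_of_nonneg (hm j)
  have hN : ∀ j, Tendsto (fun m : ℕ => (N m j : ℝ) / m) atTop (𝓝 (r j)) := fun j =>
    (hκ j).congr' (hcast.mono fun m hm => by rw [← hm j]; simp)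
  let n : ℕ → ℕ := fun m => ∑ a, N m (.inl a)
  let w : ℕ → ℕ := fun m => ∑ a, N m (.inl a) * hammingNorm a
  have hn : Tendsto (fun m : ℕ => (n m : ℝ) / m) atTop (𝓝 1) := by
    rw [← h1]
    refine (tendsto_finsetSum _ fun a _ => hN (.inl a)).congr fun m => ?_
    rw [← Finset.sum_div]
    push_cast [n]
    rfl
  have hw : Tendsto (fun m : ℕ => (w m : ℝ) / m) atTop (𝓝 α) := by
    rw [← h4]
    refine (tendsto_finsetSum _ fun a _ => (hN (.inl a)).mul_const _).congr fun m => ?_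
    simp only [div_mul_eq_mul_div, ← Finset.sum_div]
    push_cast [w]
    rfl
  refine ⟨N, n, w, ?_, ?_, ?_, ?_⟩
  · filter_upwards [hcast] with m hm
    have k0 := hκM m 0
    have k1 := hκM m 1
    simp only [← hm, Fintype.sum_sum_type] at k0 k1
    simp [M] at k0 k1
    refine ⟨rfl, ?_, rfl, ?_⟩
    · zify
      push_cast [n]
      rw [← Finset.mul_sum, ← Finset.mul_sum] at k0
      linarith
    · zify
      simp only [mul_comm (N m _ : ℤ)]
      linarith
  · filter_upwards [hcast] with m hm
    have k2 := hκM m 2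
    simp only [← hm] at k2
    exact k2
  · have h5 := hn.pos_mul_atTop one_pos (tendsto_natCast_atTop_atTop (R := ℝ))
    refine tendsto_natCast_atTop_iff.1 (h5.congr' ?_)
    filter_upwards [eventually_gt_atTop 0] with m hm
    have hm' : (m : ℝ) ≠ 0 := by exact_mod_cast hm.ne'
    field_simp
  · have h5 := hw.div hn one_ne_zero
    rw [div_one] at h5
    refine h5.congr' ?_
    filter_upwards [eventually_gt_atTop 0] with m hm
    have hm' : (m : ℝ) ≠ 0 := by exact_mod_cast hm.ne'
    simp only [Pi.div_apply]
    rw [div_div_div_cancel_right₀ hm']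

lemma eventually_expNumCodewords_eq_zero {α : ℝ} (h : 𝓜.typePolytope α = ∅) :
    ∀ᶠ p in 𝓜.weightFilter α, 𝓜.expNumCodewords p.1 p.2 = 0 := by
  filter_upwards [eventually_notMem_of_disjoint (𝓜 := 𝓜) (α := α) isClosed_univ (by simp [h]),
    𝓜.eventually_dvd_weightFilter α] with x hx hd
  by_contra hne
  have h0 : 0 ≤ 𝓜.expNumCodewords x.1 x.2 := by
    rw [expNumCodewords]
    positivity
  obtain ⟨N, hN⟩ := exists_isCompat_of_pos hd (lt_of_le_of_ne h0 (Ne.symm hne))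
  exact hx N hN (Set.mem_univ _)

/-- Integer types approximating the maximizer show that positive expectations occur. The limit is
squeezed between the contribution of one type near the maximizer and the bound over all types, both
with error `logError n / n`. -/
lemma hasGrowthRate_of_isGreatest (hk : 0 < k) {α g : ℝ}
    (hg : IsGreatest (𝓜.exponent '' 𝓜.typePolytope α) g) : 𝓜.HasGrowthRate α g := by
  obtain ⟨⟨r, hr, rfl⟩, hub⟩ := hg
  refine ⟨?_, ?_, ?_⟩
  · obtain ⟨N, n, w, hN, -, hn, hw⟩ := exists_tendsto_isCompat hr 0 (by simp)
    have ht : Tendsto (fun m => (n m, w m)) atTop (𝓜.weightFilter α) := by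
      refine tendsto_inf.2 ⟨tendsto_inf.2 ⟨tendsto_comap_iff.2 hn, tendsto_comap_iff.2 hw⟩, ?_⟩
      exact tendsto_principal.2 (hN.mono fun m hm => hm.dvd)
    refine ht.frequently (Eventually.frequently ?_)
    filter_upwards [hN, hn.eventually_gt_atTop 0] with m hm hm0
    exact (le_log_expNumCodewords hk hm0 hm).1
  · rintro ⟨a, rfl⟩
    -- With `α = num / den`, the extra equation `den * w = num * n` forces `w = α * n` exactly.
    obtain ⟨N, n, w, hN, hc, hn, -⟩ := exists_tendsto_isCompat hr
      (Sum.elim (fun b => (a.den : ℤ) * hammingNorm b - a.num) fun _ => 0) (by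
        obtain ⟨⟨-, h1, -⟩, h4⟩ := hr
        rw [inputMean] at h4
        simp only [Fintype.sum_sum_type]
        have e : ∀ b : Fin k → ZMod 2, ((a.den : ℝ) * hammingNorm b - a.num) * r (.inl b) =
          a.den * (r (.inl b) * hammingNorm b) - a.num * r (.inl b) := fun b => by ring
        simp [e, Finset.sum_sub_distrib, ← Finset.mul_sum, h1, h4]
        have : (a.den : ℝ) ≠ 0 := by exact_mod_cast a.den_ne_zero
        rw [Rat.cast_def]
        field_simp
        ring)
    refine hn.frequently (Eventually.frequently ?_)
    filter_upwards [hN, hc, hn.eventually_gt_atTop 0] with m hm hcm hm0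
    refine ⟨hm.dvd, w m, ?_, (le_log_expNumCodewords hk hm0 hm).1⟩
    simp only [Fintype.sum_sum_type] at hcm
    simp only [Sum.elim_inl, Sum.elim_inr, zero_mul, Finset.sum_const_zero, add_zero, sub_mul,
      Finset.sum_sub_distrib, mul_assoc, ← Finset.mul_sum] at hcm
    have e1 : ∑ b, (hammingNorm b : ℤ) * N m (.inl b) = w m := by
      rw [← hm.input]
      push_cast
      exact Finset.sum_congr rfl fun b _ => mul_comm _ _
    have e2 : ∑ b, (N m (.inl b) : ℤ) = n m := by exact_mod_cast hm.vn
    rw [e1, e2] at hcm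
    have e3 : (a.den : ℝ) * w m = a.num * n m := by exact_mod_cast sub_eq_zero.1 hcm
    have : (a.den : ℝ) ≠ 0 := by exact_mod_cast a.den_ne_zero
    rw [Rat.cast_def]
    field_simp
    linarith
  · have herr := tendsto_logError_div (𝓜 := 𝓜) hk
    refine tendsto_order.2 ⟨fun b hb => ?_, fun b hb => ?_⟩
    -- A maximizer may lie on a face. A small step towards a point of maximal support gives it that
    -- support and, by continuity, keeps the exponent above `b'`.
    · obtain ⟨r₁, hr₁, hmax⟩ := exists_maximal_support (𝓜.convex_typePolytope α)
        (fun r hr => hr.1.1) ⟨r, hr⟩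
      obtain ⟨b', hbb', hb'⟩ := exists_between hb
      obtain ⟨r₂, hr₂, hmax₂, hexp⟩ : ∃ r₂ ∈ 𝓜.typePolytope α,
          (∀ r' ∈ 𝓜.typePolytope α, ∀ j, 0 < r' j → 0 < r₂ j) ∧ b' < 𝓜.exponent r₂ := by
        have hcont : Continuous fun t : ℝ => 𝓜.exponent (r + t • (r₁ - r)) :=
          𝓜.continuous_exponent.comp (by fun_prop)
        have hev : ∀ᶠ t in 𝓝[>] (0 : ℝ), b' < 𝓜.exponent (r + t • (r₁ - r)) := by
          refine nhdsWithin_le_nhds ((hcont.tendsto 0).eventually_const_lt ?_)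
          simpa using hb'
        obtain ⟨t, ⟨ht1, ht2⟩, ht0⟩ := ((hev.and (nhdsWithin_le_nhds
          (eventually_lt_nhds (zero_lt_one' ℝ)))).and self_mem_nhdsWithin).exists
        have ht0' : 0 < t := ht0
        refine ⟨r + t • (r₁ - r), (𝓜.convex_typePolytope α).add_smul_sub_mem hr hr₁
          ⟨ht0'.le, ht2.le⟩, fun r' hr' j hj => ?_, ht1⟩
        have e1 := hmax r' hr' j hj
        have e2 := hr.1.1 j
        simp only [Pi.add_apply, Pi.smul_apply, Pi.sub_apply, smul_eq_mul]
        nlinarith [mul_pos ht0' e1, mul_nonneg (sub_nonneg.2 ht2.le) e2]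
      have hnb : 𝓜.exponent ⁻¹' Set.Ioi b' ∈ 𝓝 r₂ :=
        𝓜.continuous_exponent.continuousAt (Ioi_mem_nhds hexp)
      obtain ⟨ε, hε, hball⟩ := Metric.mem_nhds_iff.1 hnb
      have hsmall : ∀ᶠ n : ℕ in atTop, 𝓜.logError n / n < b' - b :=
        herr.eventually_lt_const (by linarith)
      rw [eventually_inf_principal]
      filter_upwards [eventually_exists_isCompat_near hr₂ hmax₂ (half_pos hε),
        𝓜.eventually_fst_weightFilter α (eventually_gt_atTop 0),
        𝓜.eventually_fst_weightFilter α hsmall, 𝓜.eventually_dvd_weightFilter α]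
        with x hx hn hlt hd hpos
      obtain ⟨N, hN⟩ := exists_isCompat_of_pos hd hpos
      obtain ⟨N', hN', hnear⟩ := hx N hN
      have hmem : (fun j => (N' j : ℝ) / x.1) ∈ Metric.ball r₂ ε := by
        rw [Metric.mem_ball]
        refine lt_of_le_of_lt ((dist_pi_le_iff (half_pos hε).le).2 fun j => ?_) (half_lt_self hε)
        rw [Real.dist_eq]
        exact (hnear j).le
      have h1 : b' < 𝓜.exponent fun j => (N' j : ℝ) / x.1 := hball hmem
      have h2 := (le_log_expNumCodewords hk hn hN').2
      have hn' : (0 : ℝ) < x.1 := by exact_mod_cast hn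
      rw [div_lt_iff₀ hn'] at hlt
      rw [one_div_mul_eq_div, lt_div_iff₀ hn']
      nlinarith
    · obtain ⟨b', hbb', hb'⟩ := exists_between hb
      have hsmall : ∀ᶠ n : ℕ in atTop, 𝓜.logError n / n < b - b' :=
        herr.eventually_lt_const (by linarith)
      have hC : IsClosed (𝓜.exponent ⁻¹' Set.Ici b') := isClosed_Ici.preimage 𝓜.continuous_exponent
      have hd : Disjoint (𝓜.exponent ⁻¹' Set.Ici b') (𝓜.typePolytope α) :=
        Set.disjoint_left.2 fun y hy hy' =>
          absurd (hbb'.trans_le hy) (not_lt.2 (hub ⟨y, hy', rfl⟩))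
      rw [eventually_inf_principal]
      filter_upwards [eventually_notMem_of_disjoint hC hd,
        𝓜.eventually_fst_weightFilter α (eventually_gt_atTop 0),
        𝓜.eventually_fst_weightFilter α hsmall, 𝓜.eventually_dvd_weightFilter α]
        with x hx hn hlt hd hpos
      have h1 := log_expNumCodewords_le hk hn hd hpos (b := b') fun N hN =>
        (not_le.1 (hx N hN)).le
      have hn' : (0 : ℝ) < x.1 := by exact_mod_cast hn
      rw [div_lt_iff₀ hn'] at hlt
      rw [one_div_mul_eq_div, div_lt_iff₀ hn']
      nlinarith

variable (𝓜)

/-! ### The range of the mean local codeword weight of the VNs -/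

lemma setOf_ioCoeff_pos (i : ℕ) : {j | 0 < ioCoeff 𝓜.vnRep i j} =
    𝓜.outWeight '' {a : Fin k → ZMod 2 | hammingNorm a = i} := by
  ext j
  simp only [Set.mem_ofPred_eq, Set.mem_image]
  rw [ioCoeff_eq_card, Finset.card_pos]
  simp [Finset.Nonempty, outWeight]

lemma exists_hammingNorm_eq {i : ℕ} (hi : i ≤ k) : ∃ a : Fin k → ZMod 2, hammingNorm a = i := by
  obtain ⟨t, -, ht⟩ := Finset.exists_subset_card_eq
    (show i ≤ #(Finset.univ : Finset (Fin k)) by simpa using hi)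
  refine ⟨fun j => if j ∈ t then 1 else 0, ?_⟩
  rw [hammingNorm, ← ht]
  congr 1
  ext j
  simp

lemma U_le_outWeight (a : Fin k → ZMod 2) : 𝓜.U (hammingNorm a) ≤ 𝓜.outWeight a := by
  rw [U, setOf_ioCoeff_pos]
  exact Nat.sInf_le ⟨a, rfl, rfl⟩

lemma outWeight_le_V (a : Fin k → ZMod 2) : 𝓜.outWeight a ≤ 𝓜.V (hammingNorm a) := by
  rw [V, setOf_ioCoeff_pos]
  exact le_csSup (Set.toFinite _).bddAbove ⟨a, rfl, rfl⟩

lemma exists_outWeight_eq_U {i : ℕ} (hi : i ≤ k) :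
    ∃ a : Fin k → ZMod 2, hammingNorm a = i ∧ 𝓜.outWeight a = 𝓜.U i := by
  obtain ⟨a, ha⟩ := exists_hammingNorm_eq hi
  rw [U, setOf_ioCoeff_pos]
  exact Nat.sInf_mem (s := 𝓜.outWeight '' {a : Fin k → ZMod 2 | hammingNorm a = i}) ⟨_, a, ha, rfl⟩

lemma exists_outWeight_eq_V {i : ℕ} (hi : i ≤ k) :
    ∃ a : Fin k → ZMod 2, hammingNorm a = i ∧ 𝓜.outWeight a = 𝓜.V i := by
  obtain ⟨a, ha⟩ := exists_hammingNorm_eq hi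
  rw [V, setOf_ioCoeff_pos]
  exact Nat.sSup_mem (s := 𝓜.outWeight '' {a : Fin k → ZMod 2 | hammingNorm a = i}) ⟨_, a, ha, rfl⟩
    (Set.toFinite _).bddAbove

lemma U_zero : 𝓜.U 0 = 0 := by
  have h := 𝓜.U_le_outWeight 0
  rwa [hammingNorm_zero, outWeight_zero, Nat.le_zero] at h

lemma V_zero : 𝓜.V 0 = 0 := by
  obtain ⟨a, h1, h2⟩ := 𝓜.exists_outWeight_eq_V (Nat.zero_le k)
  rw [← h2, hammingNorm_eq_zero.1 h1, outWeight_zero]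

/-- Distributions of VN input words with mean weight `α`. -/
def vnSpace (_ : StronglyRegularEnsemble k q s) (α : ℝ) : Set ((Fin k → ZMod 2) → ℝ) :=
  {p | (∀ a, 0 ≤ p a) ∧ ∑ a, p a = 1 ∧ ∑ a, p a * hammingNorm a = α}

/-- The mean weight of the local codeword of a VN. -/
def outMean : ((Fin k → ZMod 2) → ℝ) →L[ℝ] ℝ :=
  ∑ a, (𝓜.outWeight a : ℝ) • ContinuousLinearMap.proj (R := ℝ) (φ := fun _ => ℝ) a

lemma outMean_apply (p : (Fin k → ZMod 2) → ℝ) : 𝓜.outMean p = ∑ a, p a * 𝓜.outWeight a := by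
  simp [outMean, _root_.sum_apply, mul_comm]

lemma isCompact_nonneg_sum_eq {S : Type*} [Fintype S] (σ : ℝ) :
    IsCompact {t : S → ℝ | (∀ i, 0 ≤ t i) ∧ ∑ i, t i = σ} := by
  have hc : IsClosed {t : S → ℝ | (∀ i, 0 ≤ t i) ∧ ∑ i, t i = σ} := by
    have h1 : IsClosed {r : S → ℝ | ∀ j, 0 ≤ r j} := by
      rw [Set.ofPred_forall]
      exact isClosed_iInter fun j => isClosed_le continuous_const (continuous_apply j)
    have h2 : IsClosed {r : S → ℝ | ∑ a, r a = σ} := isClosed_eq (by fun_prop) continuous_const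
    exact h1.inter h2
  refine IsCompact.of_isClosed_subset
    (isCompact_univ_pi fun _ : S => isCompact_Icc (a := (0 : ℝ)) (b := σ)) hc ?_
  rintro t ⟨h0, h1⟩ j -
  exact ⟨h0 j, h1 ▸ Finset.single_le_sum (fun i _ => h0 i) (mem_univ j)⟩

lemma convex_nonneg_sum_eq {S : Type*} [Fintype S] (σ : ℝ) :
    Convex ℝ {t : S → ℝ | (∀ i, 0 ≤ t i) ∧ ∑ i, t i = σ} := by
  rintro r ⟨h0, h1⟩ r' ⟨h0', h1'⟩ a b ha hb hab
  refine ⟨fun j => add_nonneg (mul_nonneg ha (h0 j)) (mul_nonneg hb (h0' j)), ?_⟩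
  simp only [Pi.add_apply, Pi.smul_apply, smul_eq_mul, Finset.sum_add_distrib, ← Finset.mul_sum,
    h1, h1']
  rw [← add_mul, hab, one_mul]

lemma isCompact_vnSpace (α : ℝ) : IsCompact (𝓜.vnSpace α) := by
  have h1 : IsClosed {p : (Fin k → ZMod 2) → ℝ | ∑ a, p a * hammingNorm a = α} :=
    isClosed_eq (by fun_prop) continuous_const
  convert (isCompact_nonneg_sum_eq (S := Fin k → ZMod 2) 1).inter_right h1 using 1
  ext p
  simp [vnSpace, and_assoc]

lemma convex_vnSpace (α : ℝ) : Convex ℝ (𝓜.vnSpace α) := by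
  rintro r ⟨h0, h1, h2⟩ r' ⟨h0', h1', h2'⟩ a b ha hb hab
  obtain ⟨e1, e2⟩ := convex_nonneg_sum_eq 1 ⟨h0, h1⟩ ⟨h0', h1'⟩ ha hb hab
  refine ⟨e1, e2, ?_⟩
  simp only [Pi.add_apply, Pi.smul_apply, smul_eq_mul, add_mul, mul_assoc, Finset.sum_add_distrib,
    ← Finset.mul_sum, h2, h2']
  rw [← add_mul, hab, one_mul]

/-- The masses of the nonzero weights. -/
def weightMass (p : (Fin k → ZMod 2) → ℝ) (i : Fin k) : ℝ :=
  ∑ a with hammingNorm a = (i : ℕ) + 1, p a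

/-- Weight zero is split off because feasible vectors record only the weights `1, …, k`. -/
lemma sum_mul_comp_hammingNorm (p : (Fin k → ZMod 2) → ℝ) (f : ℕ → ℝ) :
    ∑ a, p a * f (hammingNorm a) =
      f 0 * p 0 + ∑ i : Fin k, f ((i : ℕ) + 1) * weightMass p i := by
  have hmaps : ∀ a ∈ (Finset.univ : Finset (Fin k → ZMod 2)),
      hammingNorm a ∈ Finset.range (k + 1) := fun a _ => by
    have h1 := hammingNorm_le_card_fintype (x := a)
    simp only [Fintype.card_fin] at h1
    exact Finset.mem_range.2 (by lia)
  have h1 : ∀ i, ∑ a with hammingNorm a = i, p a * f (hammingNorm a) =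
      f i * ∑ a : Fin k → ZMod 2 with hammingNorm a = i, p a := fun i => by
    rw [Finset.mul_sum]
    refine Finset.sum_congr rfl fun a ha => ?_
    rw [(Finset.mem_filter.1 ha).2, mul_comm]
  rw [← Finset.sum_fiberwise_of_maps_to hmaps, Finset.sum_range_succ', add_comm]
  simp only [h1]
  congr 1
  · congr 1
    have : ({a : Fin k → ZMod 2 | hammingNorm a = 0} : Finset _) = {0} := by
      ext a
      simp
    rw [this, Finset.sum_singleton]
  · exact (Fin.sum_univ_eq_sum_range
      (fun i => f (i + 1) * ∑ a : Fin k → ZMod 2 with hammingNorm a = i + 1, p a) k).symm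

lemma weightMass_mem_feasible {α : ℝ} {p : (Fin k → ZMod 2) → ℝ} (hp : p ∈ 𝓜.vnSpace α) :
    weightMass p ∈ 𝓜.feasible α := by
  obtain ⟨h0, h1, h2⟩ := hp
  refine ⟨fun i => Finset.sum_nonneg fun a _ => h0 a, ?_, ?_⟩
  · have := sum_mul_comp_hammingNorm p fun _ => 1
    simp only [mul_one, one_mul, h1] at this
    linarith [h0 0]
  · have := sum_mul_comp_hammingNorm p fun i => (i : ℝ)
    rw [h2] at this
    push_cast at this
    linarith

/-- Each weight puts its mass on the single word `b i`, and the remaining mass goes to the zero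
word, which adds no weight. -/
lemma exists_mem_vnSpace_of_feasible {α : ℝ} {ω : Fin k → ℝ} (hω : ω ∈ 𝓜.feasible α)
    (b : Fin k → Fin k → ZMod 2) (hb : ∀ i, hammingNorm (b i) = (i : ℕ) + 1) :
    ∃ p ∈ 𝓜.vnSpace α, 𝓜.outMean p = ∑ i, (𝓜.outWeight (b i) : ℝ) * ω i := by
  obtain ⟨h0, h1, h2⟩ := hω
  let p : (Fin k → ZMod 2) → ℝ := fun a =>
    (if a = 0 then 1 - ∑ i, ω i else 0) + ∑ i, if a = b i then ω i else 0
  have hsum : ∀ f : (Fin k → ZMod 2) → ℝ,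
      ∑ a, p a * f a = (1 - ∑ i, ω i) * f 0 + ∑ i, ω i * f (b i) := by
    intro f
    simp only [p, add_mul, Finset.sum_add_distrib, Finset.sum_mul, ite_mul, zero_mul]
    congr 1
    · simp
    · rw [Finset.sum_comm]
      simp
  refine ⟨p, ⟨fun a => ?_, ?_, ?_⟩, ?_⟩
  · refine add_nonneg ?_ (Finset.sum_nonneg fun i _ => ?_)
    · split_ifs
      · linarith
      · exact le_rfl
    · split_ifs
      · exact h0 i
      · exact le_rfl
  · have := hsum fun _ => 1
    simp only [mul_one] at this
    rw [this]
    ring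
  · rw [hsum fun a => (hammingNorm a : ℝ), ← h2]
    simp only [hb, hammingNorm_zero]
    push_cast
    rw [mul_zero, zero_add]
    exact Finset.sum_congr rfl fun i _ => mul_comm _ _
  · rw [outMean_apply, hsum fun a => (𝓜.outWeight a : ℝ), outWeight_zero]
    push_cast
    rw [mul_zero, zero_add]
    exact Finset.sum_congr rfl fun i _ => mul_comm _ _

lemma feasible_nonempty {α : ℝ} (h₀ : 0 < α) (h₁ : α < k) : (𝓜.feasible α).Nonempty := by
  have hk : (0 : ℝ) < k := h₀.trans h₁
  have hk' : 0 < k := by exact_mod_cast hk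
  -- Index `k - 1` stands for weight `k`.
  refine ⟨Pi.single ⟨k - 1, by lia⟩ (α / k), fun i => ?_, ?_, ?_⟩
  · rw [Pi.single_apply]
    split_ifs
    · positivity
    · exact le_rfl
  · rw [Finset.sum_pi_single']
    simpa using (div_le_one hk).2 h₁.le
  · simp only [Pi.single_apply, mul_ite, mul_zero]
    rw [Finset.sum_ite_eq' Finset.univ]
    simp only [Finset.mem_univ, if_true]
    rw [Nat.cast_sub (by lia)]
    push_cast
    field_simp
    ring

/-- The image is compact and connected, hence an interval. For given weight masses the mean is
extremal when each weight uses a word of least or greatest output weight, which identifies the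
endpoints. -/
lemma image_outMean_vnSpace {α : ℝ} (h₀ : 0 < α) (h₁ : α < k) :
    𝓜.outMean '' 𝓜.vnSpace α = Set.Icc (𝓜.lower α) (𝓜.upper α) := by
  choose bU hU1 hU2 using fun i : Fin k => 𝓜.exists_outWeight_eq_U (i := (i : ℕ) + 1) (by lia)
  choose bV hV1 hV2 using fun i : Fin k => 𝓜.exists_outWeight_eq_V (i := (i : ℕ) + 1) (by lia)
  obtain ⟨ω₀, hω₀⟩ := 𝓜.feasible_nonempty h₀ h₁
  obtain ⟨p₀, hp₀, -⟩ := 𝓜.exists_mem_vnSpace_of_feasible hω₀ bU hU1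
  have hc : IsCompact (𝓜.outMean '' 𝓜.vnSpace α) :=
    (𝓜.isCompact_vnSpace α).image 𝓜.outMean.continuous
  have hne : (𝓜.outMean '' 𝓜.vnSpace α).Nonempty := ⟨_, p₀, hp₀, rfl⟩
  have hconn : IsConnected (𝓜.outMean '' 𝓜.vnSpace α) :=
    ⟨hne, ((𝓜.convex_vnSpace α).isPreconnected).image _ 𝓜.outMean.continuous.continuousOn⟩
  have hlow : 𝓜.lower α = sInf (𝓜.outMean '' 𝓜.vnSpace α) := by
    have hsub : (fun ω : Fin k → ℝ => ∑ i : Fin k, (𝓜.U (i + 1) : ℝ) * ω i) '' 𝓜.feasible α ⊆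
        𝓜.outMean '' 𝓜.vnSpace α := by
      rintro _ ⟨ω, hω, rfl⟩
      obtain ⟨p, hp, hpe⟩ := 𝓜.exists_mem_vnSpace_of_feasible hω bU hU1
      exact ⟨p, hp, by rw [hpe]; simp only [hU2]⟩
    obtain ⟨⟨p, hp, hpe⟩, hleast⟩ := hc.isLeast_sInf hne
    refine IsLeast.csInf_eq ⟨?_, fun x hx => hleast (hsub hx)⟩
    have hmem : ∑ i : Fin k, (𝓜.U (i + 1) : ℝ) * weightMass p i ∈
        (fun ω : Fin k → ℝ => ∑ i : Fin k, (𝓜.U (i + 1) : ℝ) * ω i) '' 𝓜.feasible α :=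
      ⟨_, 𝓜.weightMass_mem_feasible hp, rfl⟩
    have hle : ∑ i : Fin k, (𝓜.U (i + 1) : ℝ) * weightMass p i ≤ 𝓜.outMean p := by
      have := sum_mul_comp_hammingNorm p fun i => (𝓜.U i : ℝ)
      rw [U_zero, Nat.cast_zero, zero_mul, zero_add] at this
      rw [← this, outMean_apply]
      refine Finset.sum_le_sum fun a _ => mul_le_mul_of_nonneg_left ?_ (hp.1 a)
      exact_mod_cast 𝓜.U_le_outWeight a
    rwa [← le_antisymm (hpe ▸ hle) (hleast (hsub hmem))]
  have hupp : 𝓜.upper α = sSup (𝓜.outMean '' 𝓜.vnSpace α) := by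
    have hsub : (fun ω : Fin k → ℝ => ∑ i : Fin k, (𝓜.V (i + 1) : ℝ) * ω i) '' 𝓜.feasible α ⊆
        𝓜.outMean '' 𝓜.vnSpace α := by
      rintro _ ⟨ω, hω, rfl⟩
      obtain ⟨p, hp, hpe⟩ := 𝓜.exists_mem_vnSpace_of_feasible hω bV hV1
      exact ⟨p, hp, by rw [hpe]; simp only [hV2]⟩
    obtain ⟨⟨p, hp, hpe⟩, hgreat⟩ := hc.isGreatest_sSup hne
    refine IsGreatest.csSup_eq ⟨?_, fun x hx => hgreat (hsub hx)⟩
    have hmem : ∑ i : Fin k, (𝓜.V (i + 1) : ℝ) * weightMass p i ∈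
        (fun ω : Fin k → ℝ => ∑ i : Fin k, (𝓜.V (i + 1) : ℝ) * ω i) '' 𝓜.feasible α :=
      ⟨_, 𝓜.weightMass_mem_feasible hp, rfl⟩
    have hle : 𝓜.outMean p ≤ ∑ i : Fin k, (𝓜.V (i + 1) : ℝ) * weightMass p i := by
      have := sum_mul_comp_hammingNorm p fun i => (𝓜.V i : ℝ)
      rw [V_zero, Nat.cast_zero, zero_mul, zero_add] at this
      rw [← this, outMean_apply]
      refine Finset.sum_le_sum fun a _ => mul_le_mul_of_nonneg_left ?_ (hp.1 a)
      exact_mod_cast 𝓜.outWeight_le_V a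
    rwa [← le_antisymm (hgreat (hsub hmem)) (hpe ▸ hle)]
  rw [hlow, hupp]
  exact eq_Icc_of_connected_compact hconn hc

/-- A positive mean input weight puts mass on a nonzero word, and that word has nonzero encoding. So
the condition `0 < β` excludes no limiting type. -/
lemma outMean_pos {α : ℝ} (h₀ : 0 < α) {p : (Fin k → ZMod 2) → ℝ} (hp : p ∈ 𝓜.vnSpace α) :
    0 < 𝓜.outMean p := by
  obtain ⟨hp0, -, hp2⟩ := hp
  rw [outMean_apply]
  have hne : ∃ a ∈ Finset.univ, 0 < p a * (hammingNorm a : ℝ) := by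
    by_contra! h
    have := Finset.sum_nonpos h
    linarith
  obtain ⟨a, -, ha⟩ := hne
  have ha0 : a ≠ 0 := by
    rintro rfl
    simp at ha
  have hpa : 0 < p a := lt_of_le_of_ne (hp0 a) fun h => by simp [← h] at ha
  have hv : (0 : ℝ) < 𝓜.outWeight a := by exact_mod_cast 𝓜.outWeight_pos ha0
  exact (mul_pos hpa hv).trans_le (Finset.single_le_sum
    (f := fun a => p a * (𝓜.outWeight a : ℝ))
    (fun b _ => mul_nonneg (hp0 b) (Nat.cast_nonneg _)) (mem_univ a))

/-! ### The VN saddle-point equations -/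

/-- The truncated exponent at `u = 0` is harmless because of the factor `u`. -/
lemma mul_natCast_pow_sub_one (x : ℝ) (u : ℕ) : x * (u * x ^ (u - 1)) = u * x ^ u := by
  rcases u with _ | u
  · simp
  · rw [Nat.add_sub_cancel, pow_succ]
    ring

lemma B_pos {x y : ℝ} (hx : 0 < x) (hy : 0 < y) : 0 < 𝓜.B x y := by
  rw [B_eq_sum]
  exact Finset.sum_pos (fun a _ => by positivity) Finset.univ_nonempty

lemma isVNSaddle_iff {α β x y : ℝ} (hx : 0 < x) (hy : 0 < y) : 𝓜.IsVNSaddle α β x y ↔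
    ∑ a : Fin k → ZMod 2, (hammingNorm a - α) * (x ^ hammingNorm a * y ^ 𝓜.outWeight a) = 0 ∧
    ∑ a : Fin k → ZMod 2, (𝓜.outWeight a - β) * (x ^ hammingNorm a * y ^ 𝓜.outWeight a) = 0 := by
  have hB := 𝓜.B_pos hx hy
  have d1 : deriv (fun t => 𝓜.B t y) x * x = ∑ a : Fin k → ZMod 2,
      (hammingNorm a : ℝ) * (x ^ hammingNorm a * y ^ 𝓜.outWeight a) := by
    have : HasDerivAt (fun t => 𝓜.B t y) (∑ a : Fin k → ZMod 2,
        (hammingNorm a * x ^ (hammingNorm a - 1)) * y ^ 𝓜.outWeight a) x := by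
      simp only [B_eq_sum]
      exact HasDerivAt.fun_sum fun a _ => (hasDerivAt_pow _ _).mul_const _
    rw [this.deriv, Finset.sum_mul]
    refine Finset.sum_congr rfl fun a _ => ?_
    linear_combination y ^ 𝓜.outWeight a * mul_natCast_pow_sub_one x (hammingNorm a)
  have d2 : deriv (fun t => 𝓜.B x t) y * y = ∑ a : Fin k → ZMod 2,
      (𝓜.outWeight a : ℝ) * (x ^ hammingNorm a * y ^ 𝓜.outWeight a) := by
    have : HasDerivAt (fun t => 𝓜.B x t) (∑ a : Fin k → ZMod 2,
        x ^ hammingNorm a * (𝓜.outWeight a * y ^ (𝓜.outWeight a - 1))) y := by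
      simp only [B_eq_sum]
      exact HasDerivAt.fun_sum fun a _ => (hasDerivAt_pow _ _).const_mul _
    rw [this.deriv, Finset.sum_mul]
    refine Finset.sum_congr rfl fun a _ => ?_
    linear_combination x ^ hammingNorm a * mul_natCast_pow_sub_one y (𝓜.outWeight a)
  simp only [IsVNSaddle, hx, hy, true_and, sub_mul, Finset.sum_sub_distrib, ← Finset.mul_sum,
    ← B_eq_sum]
  rw [div_mul_eq_mul_div, div_mul_eq_mul_div, d1, d2, div_eq_iff hB.ne', div_eq_iff hB.ne',
    sub_eq_zero, sub_eq_zero]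

/-- The linear functionals whose exponentials are the terms of `B(x, y) / (x ^ α * y ^ β)`. -/
def vnFunctional (α β : ℝ) (a : Fin k → ZMod 2) : ℝ × ℝ →L[ℝ] ℝ :=
  ((hammingNorm a : ℝ) - α) • ContinuousLinearMap.fst ℝ ℝ ℝ +
    ((𝓜.outWeight a : ℝ) - β) • ContinuousLinearMap.snd ℝ ℝ ℝ

lemma vnFunctional_apply (α β : ℝ) (a : Fin k → ZMod 2) (θ : ℝ × ℝ) :
    𝓜.vnFunctional α β a θ = (hammingNorm a - α) * θ.1 + (𝓜.outWeight a - β) * θ.2 := by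
  simp [vnFunctional]

/-- In logarithmic coordinates the saddle-point equations say that `B(x, y) / (x ^ α * y ^ β)` has
zero gradient. -/
lemma isVNSaddle_exp_iff (α β : ℝ) (θ : ℝ × ℝ) : 𝓜.IsVNSaddle α β (exp θ.1) (exp θ.2) ↔
    ∑ a, exp (𝓜.vnFunctional α β a θ) • 𝓜.vnFunctional α β a = 0 := by
  rw [isVNSaddle_iff 𝓜 (exp_pos _) (exp_pos _)]
  have he : ∀ a, exp (𝓜.vnFunctional α β a θ) = exp (-(α * θ.1 + β * θ.2)) *
      (exp θ.1 ^ hammingNorm a * exp θ.2 ^ 𝓜.outWeight a) := fun a => by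
    rw [← exp_nat_mul, ← exp_nat_mul, ← exp_add, ← exp_add, vnFunctional_apply]
    congr 1
    ring
  have hd : ∀ d : ℝ × ℝ, (∑ a, exp (𝓜.vnFunctional α β a θ) • 𝓜.vnFunctional α β a) d =
      exp (-(α * θ.1 + β * θ.2)) *
      ((∑ a : Fin k → ZMod 2, (hammingNorm a - α) *
        (exp θ.1 ^ hammingNorm a * exp θ.2 ^ 𝓜.outWeight a)) * d.1 +
      (∑ a : Fin k → ZMod 2, (𝓜.outWeight a - β) *
        (exp θ.1 ^ hammingNorm a * exp θ.2 ^ 𝓜.outWeight a)) * d.2) := by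
    intro d
    simp only [_root_.sum_apply, _root_.smul_apply, smul_eq_mul, he]
    rw [Finset.sum_mul, Finset.sum_mul, ← Finset.sum_add_distrib, Finset.mul_sum]
    refine Finset.sum_congr rfl fun a _ => ?_
    rw [vnFunctional_apply]
    ring
  constructor
  · rintro ⟨h1, h2⟩
    refine ContinuousLinearMap.ext fun d => ?_
    rw [hd, h1, h2]
    simp
  · intro h
    have h1 := hd (1, 0)
    have h2 := hd (0, 1)
    rw [h] at h1 h2
    simpa [(exp_pos _).ne'] using And.intro h1.symm h2.symm

lemma hammingNorm_one : hammingNorm (1 : Fin k → ZMod 2) = k := by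
  simp [hammingNorm]

/-- Averaged over a distribution in `vnSpace α`, the functionals leave only `(outMean p - β) * d.2`.
Distributions attaining the endpoints make this positive for either sign of `d.2`. If `d.2 = 0`, the
zero and the all-one word serve, as `0 < α < k`. -/
lemma existsUnique_isVNSaddle {α β : ℝ} (h₀ : 0 < α) (h₁ : α < k)
    (hβ : β ∈ Set.Ioo (𝓜.lower α) (𝓜.upper α)) :
    ∃! p : ℝ × ℝ, 𝓜.IsVNSaddle α β p.1 p.2 := by
  have himg := 𝓜.image_outMean_vnSpace h₀ h₁
  have hlt := hβ.1.trans hβ.2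
  have hp : ∀ p ∈ 𝓜.vnSpace α, ∀ d : ℝ × ℝ,
      ∑ a, p a * 𝓜.vnFunctional α β a d = (𝓜.outMean p - β) * d.2 := by
    rintro p ⟨-, h1, h2⟩ d
    have e : ∀ a, p a * 𝓜.vnFunctional α β a d = (p a * hammingNorm a) * d.1 - p a * (α * d.1) +
        (p a * 𝓜.outWeight a * d.2 - p a * (β * d.2)) := fun a => by
      rw [vnFunctional_apply]
      ring
    simp only [e, Finset.sum_add_distrib, Finset.sum_sub_distrib, ← Finset.sum_mul, h1, h2,
      outMean_apply]
    ring
  have hex : ∀ p ∈ 𝓜.vnSpace α, ∀ d : ℝ × ℝ, 0 < (𝓜.outMean p - β) * d.2 →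
      ∃ a, 0 < 𝓜.vnFunctional α β a d := by
    intro p hpm d hpos
    by_contra! h
    rw [← hp p hpm] at hpos
    have := Finset.sum_nonpos fun a (_ : a ∈ Finset.univ) =>
      mul_nonpos_of_nonneg_of_nonpos (hpm.1 a) (h a)
    linarith
  obtain ⟨θ, hθ, huniq⟩ := existsUnique_sum_exp_smul_eq_zero (𝓜.vnFunctional α β) (by
    intro d hd
    rcases lt_trichotomy d.2 0 with h | h | h
    · obtain ⟨p, hpm, hpe⟩ := himg.ge (Set.left_mem_Icc.2 hlt.le)
      exact hex p hpm d (mul_pos_of_neg_of_neg (by rw [hpe]; linarith [hβ.1]) h)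
    · have hd1 : d.1 ≠ 0 := fun h1 => hd (Prod.ext h1 h)
      rcases lt_or_gt_of_ne hd1 with h1 | h1
      · refine ⟨0, ?_⟩
        rw [vnFunctional_apply, h, hammingNorm_zero]
        push_cast
        nlinarith
      · refine ⟨1, ?_⟩
        rw [vnFunctional_apply, h, hammingNorm_one]
        nlinarith
    · obtain ⟨p, hpm, hpe⟩ := himg.ge (Set.right_mem_Icc.2 hlt.le)
      exact hex p hpm d (mul_pos (by rw [hpe]; linarith [hβ.2]) h))
  refine ⟨(exp θ.1, exp θ.2), (𝓜.isVNSaddle_exp_iff α β θ).2 hθ, ?_⟩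
  rintro ⟨x, y⟩ hxy
  have hx : 0 < x := hxy.1
  have hy : 0 < y := hxy.2.1
  have := huniq (log x, log y) ((𝓜.isVNSaddle_exp_iff α β (log x, log y)).1
    (by simpa only [exp_log hx, exp_log hy] using hxy))
  rw [← this]
  simp [exp_log hx, exp_log hy]

/-- The distribution of VN input words given by a positive solution of the saddle-point
equations. -/
lemma tilted_mem_vnSpace {α β x y : ℝ} (h : 𝓜.IsVNSaddle α β x y) :
    (fun a => x ^ hammingNorm a * y ^ 𝓜.outWeight a / 𝓜.B x y) ∈ 𝓜.vnSpace α ∧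
      𝓜.outMean (fun a => x ^ hammingNorm a * y ^ 𝓜.outWeight a / 𝓜.B x y) = β := by
  have hx : 0 < x := h.1
  have hy : 0 < y := h.2.1
  have hB := 𝓜.B_pos hx hy
  obtain ⟨h1, h2⟩ := (𝓜.isVNSaddle_iff hx hy).1 h
  simp only [sub_mul, Finset.sum_sub_distrib, ← Finset.mul_sum, ← B_eq_sum, sub_eq_zero] at h1 h2
  refine ⟨⟨fun a => by positivity, ?_, ?_⟩, ?_⟩
  · rw [← Finset.sum_div, ← B_eq_sum, div_self hB.ne']
  · rw [← div_eq_iff hB.ne', Finset.sum_div] at h1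
    exact (Finset.sum_congr rfl fun a _ => by ring).trans h1
  · rw [← div_eq_iff hB.ne', Finset.sum_div] at h2
    rw [outMean_apply]
    exact (Finset.sum_congr rfl fun a _ => by ring).trans h2

/-- Set `y = 1` and solve the first equation alone. The tilted distribution then lies in `vnSpace
α`, where the mean output weight has only one possible value, so the second equation is automatic.
-/
lemma exists_isVNSaddle_of_lower_eq_upper {α : ℝ} (h₀ : 0 < α) (h₁ : α < k)
    (heq : 𝓜.lower α = 𝓜.upper α) : ∃ p : ℝ × ℝ, 𝓜.IsVNSaddle α (𝓜.lower α) p.1 p.2 := by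
  obtain ⟨θ, hθ, -⟩ := existsUnique_sum_exp_smul_eq_zero
    (fun a : Fin k → ZMod 2 => ((hammingNorm a : ℝ) - α) • ContinuousLinearMap.id ℝ ℝ) (by
      intro d hd
      rcases lt_or_gt_of_ne hd with h | h
      · refine ⟨0, ?_⟩
        simp only [_root_.smul_apply, smul_eq_mul, ContinuousLinearMap.id_apply, hammingNorm_zero]
        push_cast
        nlinarith
      · refine ⟨1, ?_⟩
        simp only [_root_.smul_apply, smul_eq_mul, ContinuousLinearMap.id_apply, hammingNorm_one]
        nlinarith)
  have h1 := congrArg (fun L : ℝ →L[ℝ] ℝ => L 1) hθ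
  simp only [_root_.sum_apply, _root_.smul_apply, smul_eq_mul, ContinuousLinearMap.id_apply,
    _root_.zero_apply, mul_one] at h1
  have hx := exp_pos θ
  have h2 : ∑ a : Fin k → ZMod 2,
      (hammingNorm a - α) * (exp θ ^ hammingNorm a * 1 ^ 𝓜.outWeight a) = 0 := by
    have e : ∀ a : Fin k → ZMod 2, exp (((hammingNorm a : ℝ) - α) * θ) * (hammingNorm a - α) =
        exp (-(α * θ)) *
          ((hammingNorm a - α) * (exp θ ^ hammingNorm a * 1 ^ 𝓜.outWeight a)) := fun a => by
      rw [one_pow, mul_one, ← exp_nat_mul, mul_left_comm, ← exp_add, mul_comm]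
      congr 2
      ring
    simp only [e, ← Finset.mul_sum] at h1
    exact (mul_eq_zero.1 h1).resolve_left (exp_pos _).ne'
  set β := (∑ a : Fin k → ZMod 2, (𝓜.outWeight a : ℝ) *
    (exp θ ^ hammingNorm a * 1 ^ 𝓜.outWeight a)) / 𝓜.B (exp θ) 1 with hβ
  have hsad : 𝓜.IsVNSaddle α β (exp θ) 1 := by
    refine (𝓜.isVNSaddle_iff hx one_pos).2 ⟨h2, ?_⟩
    simp only [sub_mul, Finset.sum_sub_distrib, ← Finset.mul_sum, ← B_eq_sum]
    rw [hβ, div_mul_cancel₀ _ (𝓜.B_pos hx one_pos).ne', sub_self]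
  obtain ⟨h3, h4⟩ := 𝓜.tilted_mem_vnSpace hsad
  have h5 : β ∈ Set.Icc (𝓜.lower α) (𝓜.upper α) := by
    rw [← 𝓜.image_outMean_vnSpace h₀ h₁]
    exact ⟨_, h3, h4⟩
  rw [← heq, Set.Icc_self, Set.mem_singleton_iff] at h5
  exact ⟨(exp θ, 1), h5 ▸ hsad⟩

/-- The VN term of the growth rate. -/
def vnTerm (α β : ℝ) : ℝ := sliceSup (𝓜.vnSpace α) 𝓜.outMean typeExponent β

/-- A saddle point yields a tilted distribution in the slice at `β`, which maximizes the entropy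
there. The closed form is that maximum and so does not depend on the chosen saddle point. -/
lemma isVNTerm_vnTerm {α : ℝ} (h₀ : 0 < α) (h₁ : α < k) : 𝓜.IsVNTerm α (𝓜.vnTerm α) := by
  refine ⟨?_, fun β hβ x y hxy => ?_⟩
  · rw [← 𝓜.image_outMean_vnSpace h₀ h₁]
    exact continuousOn_sliceSup (𝓜.isCompact_vnSpace α) (𝓜.convex_vnSpace α) _
      continuous_typeExponent
  have hx : 0 < x := hxy.1
  have hy : 0 < y := hxy.2.1
  have hB := 𝓜.B_pos hx hy
  rw [← 𝓜.image_outMean_vnSpace h₀ h₁] at hβ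
  have hexp : ∀ a : Fin k → ZMod 2, exp (hammingNorm a * log x + 𝓜.outWeight a * log y) =
      x ^ hammingNorm a * y ^ 𝓜.outWeight a := fun a => by
    rw [exp_add, exp_nat_mul, exp_nat_mul, exp_log hx, exp_log hy]
  have h1 := isGreatest_typeExponent_tilted
    (fun a : Fin k → ZMod 2 => hammingNorm a * log x + 𝓜.outWeight a * log y) (σ := 1)
    (b := α * log x + β * log y) one_pos {p ∈ 𝓜.vnSpace α | 𝓜.outMean p = β} (by
      rintro p ⟨⟨e1, e2, e3⟩, e4⟩
      refine ⟨e1, e2, ?_⟩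
      rw [outMean_apply] at e4
      simp only [mul_add, ← mul_assoc, Finset.sum_add_distrib, ← Finset.sum_mul, e3, e4]) (by
      simp only [hexp, one_mul, ← B_eq_sum]
      exact 𝓜.tilted_mem_vnSpace hxy)
  simp only [hexp, ← B_eq_sum, one_mul] at h1
  rw [vnTerm, (isGreatest_sliceSup (𝓜.isCompact_vnSpace α) _ continuous_typeExponent hβ).unique h1,
    Real.log_div hB.ne' (by positivity), Real.log_mul (by positivity) (by positivity),
    Real.log_rpow hx, Real.log_rpow hy]

/-! ### The CN saddle-point equation -/

lemma intLambda_eq (hq : 0 < q) : 𝓜.intLambda = 1 / q := by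
  rw [intLambda, integral_pow, Nat.sub_add_cancel hq]
  have : ((q - 1 : ℕ) : ℝ) + 1 = q := by exact_mod_cast Nat.sub_add_cancel hq
  simp [this, hq.ne']

lemma intRho_eq : 𝓜.intRho = 1 / s := by
  have hs := 𝓜.s_pos
  rw [intRho, integral_pow, Nat.sub_add_cancel hs]
  have : ((s - 1 : ℕ) : ℝ) + 1 = s := by exact_mod_cast Nat.sub_add_cancel hs
  simp [this, hs.ne']

lemma intLambda_div_intRho (hq : 0 < q) : 𝓜.intLambda / 𝓜.intRho = s / q := by
  rw [intLambda_eq 𝓜 hq, intRho_eq]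
  have : (s : ℝ) ≠ 0 := by exact_mod_cast 𝓜.s_pos.ne'
  field_simp

lemma intRho_div_intLambda (hq : 0 < q) : 𝓜.intRho / 𝓜.intLambda = q / s := by
  rw [← inv_div, intLambda_div_intRho 𝓜 hq, inv_div]

lemma A_pos {z : ℝ} (hz : 0 < z) : 0 < 𝓜.A z := by
  rw [A_eq_sum]
  exact Finset.sum_pos (fun a _ => by positivity) Finset.univ_nonempty

lemma cnMaxWeight_pos : 0 < 𝓜.cnMaxWeight := by
  obtain ⟨c, hc⟩ := 𝓜.exists_cnRep_ne_zero
  exact (hammingNorm_pos_iff.2 hc).trans_le (𝓜.hammingNorm_le_cnMaxWeight c)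

lemma isCNSaddle_iff (hq : 0 < q) {β z : ℝ} (hz : 0 < z) : 𝓜.IsCNSaddle β z ↔
    ∑ c : 𝓜.cnRep, (hammingNorm c.1 - β * (s / q)) * z ^ hammingNorm c.1 = 0 := by
  have hA := 𝓜.A_pos hz
  have d1 : deriv 𝓜.A z * z = ∑ c : 𝓜.cnRep, (hammingNorm c.1 : ℝ) * z ^ hammingNorm c.1 := by
    have : HasDerivAt 𝓜.A (∑ c : 𝓜.cnRep,
        (hammingNorm c.1 * z ^ (hammingNorm c.1 - 1) : ℝ)) z := by
      have hfun : 𝓜.A = fun t => ∑ c : 𝓜.cnRep, t ^ hammingNorm c.1 := funext 𝓜.A_eq_sum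
      rw [hfun]
      exact HasDerivAt.fun_sum fun a _ => hasDerivAt_pow _ _
    rw [this.deriv, Finset.sum_mul]
    refine Finset.sum_congr rfl fun a _ => ?_
    rw [← mul_natCast_pow_sub_one, mul_comm]
  simp only [IsCNSaddle, hz, true_and, sub_mul, Finset.sum_sub_distrib, ← Finset.mul_sum,
    ← A_eq_sum]
  rw [div_mul_eq_mul_div, d1, intLambda_div_intRho 𝓜 hq, div_eq_iff hA.ne', sub_eq_zero]

lemma isCNSaddle_exp_iff (hq : 0 < q) (β θ : ℝ) : 𝓜.IsCNSaddle β (exp θ) ↔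
    ∑ c : 𝓜.cnRep, exp (((((hammingNorm c.1 : ℝ) - β * (s / q)) •
      ContinuousLinearMap.id ℝ ℝ) : ℝ →L[ℝ] ℝ) θ) •
        ((((hammingNorm c.1 : ℝ) - β * (s / q)) • ContinuousLinearMap.id ℝ ℝ) : ℝ →L[ℝ] ℝ) = 0 := by
  rw [isCNSaddle_iff 𝓜 hq (exp_pos θ), ContinuousLinearMap.ext_iff]
  have hd : ∀ d : ℝ, (∑ c : 𝓜.cnRep, exp (((((hammingNorm c.1 : ℝ) - β * (s / q)) •
      ContinuousLinearMap.id ℝ ℝ) : ℝ →L[ℝ] ℝ) θ) •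
        ((((hammingNorm c.1 : ℝ) - β * (s / q)) • ContinuousLinearMap.id ℝ ℝ) : ℝ →L[ℝ] ℝ)) d =
      exp (-(β * (s / q) * θ)) * ((∑ c : 𝓜.cnRep, (hammingNorm c.1 - β * (s / q)) *
        exp θ ^ hammingNorm c.1) * d) := by
    intro d
    simp only [_root_.sum_apply, _root_.smul_apply, smul_eq_mul, ContinuousLinearMap.id_apply]
    rw [Finset.sum_mul, Finset.mul_sum]
    refine Finset.sum_congr rfl fun c _ => ?_
    have : exp (((hammingNorm c.1 : ℝ) - β * (s / q)) * θ) =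
        exp (-(β * (s / q) * θ)) * exp θ ^ hammingNorm c.1 := by
      rw [← exp_nat_mul, ← exp_add]
      congr 1
      ring
    rw [this]
    ring
  constructor
  · intro h d
    rw [hd, h]
    simp
  · intro h
    have h1 := hd 1
    rw [h 1, _root_.zero_apply] at h1
    simpa [(exp_pos _).ne'] using h1.symm

/-- The zero word and a word of maximal weight have weights on opposite sides of `β * (s / q)`,
which gives a positive functional in each direction. -/
lemma existsUnique_isCNSaddle (hq : 0 < q) {β : ℝ} (h₀ : 0 < β)
    (h₁ : β * (𝓜.intLambda / 𝓜.intRho) < 𝓜.cnMaxWeight) : ∃! z : ℝ, 𝓜.IsCNSaddle β z := by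
  rw [intLambda_div_intRho 𝓜 hq] at h₁
  have hs : (0 : ℝ) < s := by exact_mod_cast 𝓜.s_pos
  have hq' : (0 : ℝ) < q := by exact_mod_cast hq
  have hb : 0 < β * (s / q) := by positivity
  obtain ⟨θ, hθ, huniq⟩ := existsUnique_sum_exp_smul_eq_zero
    (fun c : 𝓜.cnRep => ((((hammingNorm c.1 : ℝ) - β * (s / q)) •
      ContinuousLinearMap.id ℝ ℝ) : ℝ →L[ℝ] ℝ)) (by
      intro d hd
      rcases lt_or_gt_of_ne hd with h | h
      · refine ⟨0, ?_⟩
        simp only [_root_.smul_apply, smul_eq_mul, ContinuousLinearMap.id_apply,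
          Submodule.coe_zero, hammingNorm_zero]
        push_cast
        nlinarith
      · obtain ⟨c, hc⟩ := 𝓜.exists_hammingNorm_eq_cnMaxWeight
        refine ⟨c, ?_⟩
        simp only [_root_.smul_apply, smul_eq_mul, ContinuousLinearMap.id_apply, hc]
        nlinarith)
  refine ⟨exp θ, (𝓜.isCNSaddle_exp_iff hq β θ).2 hθ, fun z hz => ?_⟩
  have hz0 : 0 < z := hz.1
  have := huniq (log z) ((𝓜.isCNSaddle_exp_iff hq β (log z)).1 (by rwa [exp_log hz0]))
  rw [← this, exp_log hz0]

/-- Distributions of CN codewords, normalized to one VN. -/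
def cnSpace : Set (𝓜.cnRep → ℝ) := {t | (∀ c, 0 ≤ t c) ∧ ∑ c, t c = q / s}

/-- The mean CN codeword weight, normalized to one VN. -/
def cnMean : (𝓜.cnRep → ℝ) →L[ℝ] ℝ :=
  ∑ c, (hammingNorm c.1 : ℝ) • ContinuousLinearMap.proj (R := ℝ) (φ := fun _ => ℝ) c

lemma cnMean_apply (t : 𝓜.cnRep → ℝ) : 𝓜.cnMean t = ∑ c, t c * hammingNorm c.1 := by
  simp [cnMean, _root_.sum_apply, mul_comm]

lemma isCompact_cnSpace : IsCompact 𝓜.cnSpace := isCompact_nonneg_sum_eq _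

lemma convex_cnSpace : Convex ℝ 𝓜.cnSpace := convex_nonneg_sum_eq _

lemma cnRange_subset (hq : 0 < q) : 𝓜.cnRange ⊆ 𝓜.cnMean '' 𝓜.cnSpace := by
  rintro β ⟨h₀, h₁⟩
  rw [intLambda_div_intRho 𝓜 hq] at h₁
  have hs : (0 : ℝ) < s := by exact_mod_cast 𝓜.s_pos
  have hq' : (0 : ℝ) < q := by exact_mod_cast hq
  have hd : (0 : ℝ) < 𝓜.cnMaxWeight := by exact_mod_cast 𝓜.cnMaxWeight_pos
  obtain ⟨c, hc⟩ := 𝓜.exists_hammingNorm_eq_cnMaxWeight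
  have hle : β / 𝓜.cnMaxWeight ≤ q / s := by
    rw [div_le_div_iff₀ hd hs]
    rw [mul_div_assoc', div_le_iff₀ hq'] at h₁
    linarith
  -- A mixture of the zero word and a word of maximal weight, with the masses dictated by the mean
  -- `β`.
  refine ⟨Pi.single 0 (q / s - β / 𝓜.cnMaxWeight) + Pi.single c (β / 𝓜.cnMaxWeight),
    ⟨fun i => ?_, ?_⟩, ?_⟩
  · refine add_nonneg ?_ ?_
    · rw [Pi.single_apply]
      split_ifs
      · linarith
      · exact le_rfl
    · rw [Pi.single_apply]
      split_ifs
      · positivity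
      · exact le_rfl
  · simp only [Pi.add_apply, Finset.sum_add_distrib, Finset.sum_pi_single', Finset.mem_univ,
      if_true]
    ring
  · rw [cnMean_apply]
    simp only [Pi.add_apply, add_mul, Finset.sum_add_distrib, Pi.single_apply, ite_mul, zero_mul]
    rw [Finset.sum_ite_eq' Finset.univ, Finset.sum_ite_eq' Finset.univ]
    simp only [Finset.mem_univ, if_true, Submodule.coe_zero, hammingNorm_zero, hc]
    push_cast
    field_simp
    ring

lemma cnMean_div_le (hq : 0 < q) {t : 𝓜.cnRep → ℝ} (ht : t ∈ 𝓜.cnSpace) :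
    𝓜.cnMean t * (𝓜.intLambda / 𝓜.intRho) ≤ 𝓜.cnMaxWeight := by
  have hs : (0 : ℝ) < s := by exact_mod_cast 𝓜.s_pos
  have hq' : (0 : ℝ) < q := by exact_mod_cast hq
  have h1 : 𝓜.cnMean t ≤ q / s * 𝓜.cnMaxWeight := by
    rw [cnMean_apply, ← ht.2, Finset.sum_mul]
    refine Finset.sum_le_sum fun c _ => mul_le_mul_of_nonneg_left ?_ (ht.1 c)
    exact_mod_cast 𝓜.hammingNorm_le_cnMaxWeight c
  rw [intLambda_div_intRho 𝓜 hq]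
  calc 𝓜.cnMean t * (s / q) ≤ q / s * 𝓜.cnMaxWeight * (s / q) := by gcongr
    _ = 𝓜.cnMaxWeight := by field_simp

/-- The CN term of the growth rate. -/
def cnTerm (β : ℝ) : ℝ := sliceSup 𝓜.cnSpace 𝓜.cnMean typeExponent β - chooseExponent q β

/-- The total mass `q / s` of the CN distribution becomes the exponent of `A`, and the binomial
exponent becomes the entropy term. -/
lemma isCNTerm_cnTerm (hq : 0 < q) : 𝓜.IsCNTerm 𝓜.cnTerm := by
  have hs : (0 : ℝ) < s := by exact_mod_cast 𝓜.s_pos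
  have hq' : (0 : ℝ) < q := by exact_mod_cast hq
  refine ⟨?_, fun β hβ z hz => ?_⟩
  · exact ((continuousOn_sliceSup 𝓜.isCompact_cnSpace 𝓜.convex_cnSpace _
      continuous_typeExponent).mono (𝓜.cnRange_subset hq)).sub
      (continuous_chooseExponent q).continuousOn
  have hz0 : 0 < z := hz.1
  have hA := 𝓜.A_pos hz0
  have hβ' := 𝓜.cnRange_subset hq hβ
  have hexp : ∀ c : 𝓜.cnRep, exp (hammingNorm c.1 * log z) = z ^ hammingNorm c.1 := fun c => by
    rw [exp_nat_mul, exp_log hz0]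
  have hsad := (𝓜.isCNSaddle_iff hq hz0).1 hz
  simp only [sub_mul, Finset.sum_sub_distrib, ← Finset.mul_sum, ← A_eq_sum, sub_eq_zero] at hsad
  have h1 := isGreatest_typeExponent_tilted
    (fun c : 𝓜.cnRep => hammingNorm c.1 * log z) (σ := q / s)
    (b := β * log z) (by positivity) {t ∈ 𝓜.cnSpace | 𝓜.cnMean t = β} (by
      rintro t ⟨⟨e1, e2⟩, e3⟩
      refine ⟨e1, e2, ?_⟩
      rw [cnMean_apply] at e3
      simp only [← mul_assoc, ← Finset.sum_mul, e3]) (by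
      simp only [hexp, ← A_eq_sum]
      refine ⟨⟨fun c => by positivity, ?_⟩, ?_⟩
      · rw [← Finset.mul_sum, ← Finset.sum_div, ← A_eq_sum, div_self hA.ne', mul_one]
      · rw [cnMean_apply]
        have e : ∀ c : 𝓜.cnRep, (q / s * (z ^ hammingNorm c.1 / 𝓜.A z)) * (hammingNorm c.1 : ℝ) =
            q / s / 𝓜.A z * (hammingNorm c.1 * z ^ hammingNorm c.1) := fun c => by ring
        simp only [e, ← Finset.mul_sum, hsad]
        field_simp)
  simp only [hexp, ← A_eq_sum] at h1
  rw [cnTerm, (isGreatest_sliceSup 𝓜.isCompact_cnSpace _ continuous_typeExponent hβ').unique h1,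
    intRho_div_intLambda 𝓜 hq, Real.log_div (by positivity) (by positivity), Real.log_rpow hA,
    Real.log_rpow hz0, chooseExponent_eq_binEntropy hq', intLambda_eq 𝓜 hq]
  have : β * (1 / (q : ℝ)) = β / q := by ring
  rw [this]
  field_simp

/-! ### The growth rate -/

lemma vn_part_mem {α : ℝ} {r : 𝓜.Letter → ℝ} (hr : r ∈ 𝓜.typePolytope α) :
    (fun a => r (.inl a)) ∈ 𝓜.vnSpace α :=
  ⟨fun _ => hr.1.1 _, hr.1.2.1, hr.2⟩

lemma cn_part_mem {α : ℝ} {r : 𝓜.Letter → ℝ} (hr : r ∈ 𝓜.typePolytope α) :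
    (fun c => r (.inr c)) ∈ 𝓜.cnSpace ∧
      𝓜.cnMean (fun c => r (.inr c)) = 𝓜.outMean fun a => r (.inl a) :=
  ⟨⟨fun a => hr.1.1 _, hr.1.2.2.1⟩, by rw [cnMean_apply, outMean_apply, hr.1.2.2.2]⟩

lemma outMean_mem_of_mem_typePolytope {α : ℝ} (h₀ : 0 < α) (h₁ : α < k) (hq : 0 < q)
    {r : 𝓜.Letter → ℝ} (hr : r ∈ 𝓜.typePolytope α) :
    (𝓜.outMean fun a => r (.inl a)) ∈ Set.Icc (𝓜.lower α) (𝓜.upper α) ∩ 𝓜.cnRange := by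
  refine ⟨?_, 𝓜.outMean_pos h₀ (𝓜.vn_part_mem hr), ?_⟩
  · rw [← 𝓜.image_outMean_vnSpace h₀ h₁]
    exact ⟨_, 𝓜.vn_part_mem hr, rfl⟩
  · obtain ⟨h2, h3⟩ := 𝓜.cn_part_mem hr
    rw [← h3]
    exact 𝓜.cnMean_div_le hq h2

lemma exponent_le_terms {α : ℝ} (h₀ : 0 < α) (h₁ : α < k) (hq : 0 < q)
    {r : 𝓜.Letter → ℝ} (hr : r ∈ 𝓜.typePolytope α) :
    𝓜.exponent r ≤ 𝓜.vnTerm α (𝓜.outMean fun a => r (.inl a)) +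
      𝓜.cnTerm (𝓜.outMean fun a => r (.inl a)) := by
  obtain ⟨hI, hC⟩ := 𝓜.outMean_mem_of_mem_typePolytope h₀ h₁ hq hr
  obtain ⟨h2, h3⟩ := 𝓜.cn_part_mem hr
  rw [← 𝓜.image_outMean_vnSpace h₀ h₁] at hI
  have e1 := (isGreatest_sliceSup (𝓜.isCompact_vnSpace α) _ continuous_typeExponent hI).2
    ⟨_, ⟨𝓜.vn_part_mem hr, rfl⟩, rfl⟩
  have e2 := (isGreatest_sliceSup 𝓜.isCompact_cnSpace _ continuous_typeExponent
    (𝓜.cnRange_subset hq hC)).2 ⟨_, ⟨h2, h3⟩, rfl⟩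
  rw [exponent, vnTerm, cnTerm, ← outMean_apply 𝓜 fun a => r (.inl a)]
  linarith

/-- Maximizers of the two slices at the same `β` combine to a limiting type, since equality of the
mean edge weights is the only condition linking them. -/
lemma exists_exponent_eq_terms {α β : ℝ} (h₀ : 0 < α) (h₁ : α < k) (hq : 0 < q)
    (hβ : β ∈ Set.Icc (𝓜.lower α) (𝓜.upper α) ∩ 𝓜.cnRange) :
    ∃ r ∈ 𝓜.typePolytope α, 𝓜.exponent r = 𝓜.vnTerm α β + 𝓜.cnTerm β := by
  obtain ⟨hI, hC⟩ := hβ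
  rw [← 𝓜.image_outMean_vnSpace h₀ h₁] at hI
  obtain ⟨p, ⟨hp, hpβ⟩, hpe⟩ :=
    (isGreatest_sliceSup (𝓜.isCompact_vnSpace α) _ continuous_typeExponent hI).1
  obtain ⟨t, ⟨ht, htβ⟩, hte⟩ := (isGreatest_sliceSup 𝓜.isCompact_cnSpace _ continuous_typeExponent
    (𝓜.cnRange_subset hq hC)).1
  refine ⟨Sum.elim p t, ⟨⟨?_, hp.2.1, ht.2, ?_⟩, hp.2.2⟩, ?_⟩
  · rintro (a | c)
    · exact hp.1 a
    · exact ht.1 c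
  · simp only [Sum.elim_inl, Sum.elim_inr]
    rw [← outMean_apply, ← cnMean_apply, hpβ, htβ]
  · rw [exponent, vnTerm, cnTerm, ← hpe, ← hte]
    simp only [Sum.elim_inl, Sum.elim_inr]
    rw [← outMean_apply, hpβ]
    ring

end StronglyRegularEnsemble

end DGLDPC

end

theorem mainTheorem3 {k q s : ℕ} (𝓜 : DGLDPC.StronglyRegularEnsemble k q s)
    (α : ℝ) (hα₀ : 0 < α) (hα₁ : α < k) :
    (∀ β ∈ Set.Ioo (𝓜.lower α) (𝓜.upper α), ∃! p : ℝ × ℝ, 𝓜.IsVNSaddle α β p.1 p.2) ∧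
    (𝓜.lower α = 𝓜.upper α → ∃ p : ℝ × ℝ, 𝓜.IsVNSaddle α (𝓜.lower α) p.1 p.2) ∧
    (∀ β : ℝ, 0 < β → β * (𝓜.intLambda / 𝓜.intRho) < 𝓜.cnMaxWeight →
      ∃! z : ℝ, 𝓜.IsCNSaddle β z) ∧
    (∃ X Y : ℝ → ℝ, 𝓜.IsVNTerm α X ∧ 𝓜.IsCNTerm Y ∧
      ((Set.Icc (𝓜.lower α) (𝓜.upper α) ∩ 𝓜.cnRange).Nonempty →
        ∃ g : ℝ, 𝓜.HasGrowthRate α g ∧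
          IsGreatest ((fun β => X β + Y β) ''
            (Set.Icc (𝓜.lower α) (𝓜.upper α) ∩ 𝓜.cnRange)) g)) ∧
    (Set.Icc (𝓜.lower α) (𝓜.upper α) ∩ 𝓜.cnRange = ∅ →
      ∀ᶠ p in 𝓜.weightFilter α, 𝓜.expNumCodewords p.1 p.2 = 0) := by
  have hk : 0 < k := by exact_mod_cast hα₀.trans hα₁
  have hq := 𝓜.q_pos hk
  refine ⟨fun β hβ => 𝓜.existsUnique_isVNSaddle hα₀ hα₁ hβ,
    𝓜.exists_isVNSaddle_of_lower_eq_upper hα₀ hα₁,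
    fun β h₀ h₁ => 𝓜.existsUnique_isCNSaddle hq h₀ h₁,
    ⟨𝓜.vnTerm α, 𝓜.cnTerm, 𝓜.isVNTerm_vnTerm hα₀ hα₁, 𝓜.isCNTerm_cnTerm hq, ?_⟩, fun hempty => ?_⟩
  · rintro ⟨β₀, hβ₀⟩
    obtain ⟨r₀, hr₀, -⟩ := 𝓜.exists_exponent_eq_terms hα₀ hα₁ hq hβ₀
    have hg := ((𝓜.isCompact_typePolytope α).image 𝓜.continuous_exponent).isGreatest_sSup
      ⟨_, r₀, hr₀, rfl⟩
    refine ⟨_, DGLDPC.StronglyRegularEnsemble.hasGrowthRate_of_isGreatest hk hg, ?_⟩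
    obtain ⟨⟨r, hr, hre⟩, hub⟩ := hg
    have hub' : ∀ β ∈ Set.Icc (𝓜.lower α) (𝓜.upper α) ∩ 𝓜.cnRange,
        𝓜.vnTerm α β + 𝓜.cnTerm β ≤ sSup (𝓜.exponent '' 𝓜.typePolytope α) := by
      intro β hβ
      obtain ⟨r', hr', he⟩ := 𝓜.exists_exponent_eq_terms hα₀ hα₁ hq hβ
      exact he ▸ hub ⟨r', hr', rfl⟩
    have hmem := 𝓜.outMean_mem_of_mem_typePolytope hα₀ hα₁ hq hr
    -- The mean edge weight of a maximizing limiting type is the `β` at which the maximum is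
    -- attained.
    refine ⟨⟨_, hmem, le_antisymm (hub' _ hmem) ?_⟩, ?_⟩
    · exact hre ▸ 𝓜.exponent_le_terms hα₀ hα₁ hq hr
    · rintro _ ⟨β, hβ, rfl⟩
      exact hub' β hβ
  · refine DGLDPC.StronglyRegularEnsemble.eventually_expNumCodewords_eq_zero ?_
    refine Set.eq_empty_iff_forall_notMem.2 fun r hr => ?_
    exact Set.eq_empty_iff_forall_notMem.1 hempty _
      (𝓜.outMean_mem_of_mem_typePolytope hα₀ hα₁ hq hr)
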